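/- Notation. For an integer $b\neq 0$ put $$\mathcal R_b=\varprojlim_k \frac{\mathbb Z[1/b][q]}{\big((q;q^2)_k\big)},\qquad \mathcal S_b=\varprojlim_k \frac{\mathbb Z[1/b][q]}{\big((q;q)_k\big)},$$ where $(x;y)_k=\prod_{j=0}^{k-1}(1-xy^j)$. If $\xi\in\mathbb C$ is a primitive root of unity of odd order, $\mathrm{ev}_\xi:\mathcal R_b\to\mathbb C$ is the evaluation at $q=\xi$. Since $(q;q^2)_k$ divides $(q;q)_{2k}$, there is a natural ring homomorphism $\mathcal S_b\to\mathcal R_b$ (an embedding for odd $b$), and "$Q\in\mathcal S_b$" means that $Q$ lies in its image. For integers $n,k\ge 0$ let $$A(n,k)=\frac{\prod_{i=0}^{k}\left(q^{n}+q^{-n}-q^{i}-q^{-i}\right)}{(1-q)\,(q^{k+1};q)_{k+1}}\in\mathbb Z[q^{\pm1}],\qquad [n]=\frac{q^{n/2}-q^{-n/2}}{q^{1/2}-q^{-1/2}} ,$$ and for a root of unity $\xi$ of odd order $r$ and Laurent polynomials $f(q;n)$ in $q$ let $${\sum_n}^{\xi} f=\sum_{0<n<2r,\ n\text{ odd}}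 f(\xi;n),\qquad F_{U^b}(\xi)={\sum_n}^{\xi} q^{b\frac{n^2-1}{4}}[n]^2 .$$ Theorem. Let $b=\pm1$, or $b=\pm p^l$ with $p$ prime and $l\ge 1$. For every integer $k\ge 0$ there exists an element $Q_{b,k}\in\mathcal R_b$ such that for every primitive root of unity $\xi$ of odd order $r$, where $r>2k+1$ if $k\geq 1$ (that is, where the denominator of $A(n,k)$ does not vanish at $q=\xi$; for $k=0$ every odd $r$ is allowed), one has $F_{U^b}(\xi)\neq 0$ and $$\frac{{\sum\limits_n}^{\xi}\, q^{b\frac{n^2-1}{4}}A(n,k)}{F_{U^b}(\xi)}=\mathrm{ev}_\xi(Q_{b,k}).$$ If in addition $b$ is odd, then $Q_{b,k}\in\mathcal S_b$. -/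

import Mathlib

open Polynomial

namespace LaplaceTransform

noncomputable section

/-! ### `q`-Pochhammer polynomials and cyclotomic completions -/

/-- `(q;q)_k = (1-q)(1-q^2)⋯(1-q^k)` in `R[q]`. -/
def qPoch (R : Type*) [CommRing R] (k : ℕ) : R[X] :=
  ∏ j ∈ Finset.range k, (1 - X ^ (j + 1))

/-- `(q;q^2)_k = (1-q)(1-q^3)⋯(1-q^{2k-1})` in `R[q]`. -/
def qPochOdd (R : Type*) [CommRing R] (k : ℕ) : R[X] :=
  ∏ j ∈ Finset.range k, (1 - X ^ (2 * j + 1))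

theorem qPoch_dvd (R : Type*) [CommRing R] {k m : ℕ} (h : k ≤ m) :
    qPoch R k ∣ qPoch R m :=
  Finset.prod_dvd_prod_of_subset _ _ _ (Finset.range_subset_range.2 h)

theorem qPochOdd_dvd (R : Type*) [CommRing R] {k m : ℕ} (h : k ≤ m) :
    qPochOdd R k ∣ qPochOdd R m :=
  Finset.prod_dvd_prod_of_subset _ _ _ (Finset.range_subset_range.2 h)

theorem qPochOdd_dvd_qPoch (R : Type*) [CommRing R] (k : ℕ) :
    qPochOdd R k ∣ qPoch R (2 * k) := by
  have hinj : Set.InjOn (fun j : ℕ => 2 * j) (Finset.range k : Set ℕ) := by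
    intro a _ c _ h
    simpa using h
  have h : qPochOdd R k
      = ∏ j ∈ (Finset.range k).image (fun j : ℕ => 2 * j), (1 - X ^ (j + 1) : R[X]) := by
    rw [Finset.prod_image hinj]
    rfl
  rw [h]
  apply Finset.prod_dvd_prod_of_subset
  intro j hj
  simp only [Finset.mem_image, Finset.mem_range] at hj ⊢
  omega

/-- The inverse limit `lim_k A / (f k)` over a chain `f 0 ∣ f 1 ∣ ⋯` in a commutative ring `A`,
as the ring of compatible sequences of residue classes. -/
def invLimit {A : Type*} [CommRing A] (f : ℕ → A) (hf : ∀ {k m : ℕ}, k ≤ m → f k ∣ f m) :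
    Subring (∀ k : ℕ, A ⧸ Ideal.span {f k}) where
  carrier := {x | ∀ (k m : ℕ) (h : k ≤ m),
    Ideal.Quotient.factor (Ideal.span_singleton_le_span_singleton.2 (hf h)) (x m) = x k}
  mul_mem' hx hy k m h := by simp [hx k m h, hy k m h]
  one_mem' k m h := by simp
  add_mem' hx hy k m h := by simp [hx k m h, hy k m h]
  zero_mem' k m h := by simp
  neg_mem' hx k m h := by simp [hx k m h]

/-- The ring `ℤ[1/b]`, as a subring of `ℚ`. -/
abbrev ZInv (b : ℤ) : Subalgebra ℤ ℚ := Algebra.adjoin ℤ {(b : ℚ)⁻¹}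

/-- `𝓡_b = lim_k ℤ[1/b][q] / ((q;q^2)_k)`. It depends only on `|b|`. -/
abbrev RRing (b : ℤ) : Subring (∀ k : ℕ, (ZInv b)[X] ⧸ Ideal.span {qPochOdd (ZInv b) k}) :=
  invLimit (qPochOdd (ZInv b)) (qPochOdd_dvd (ZInv b))

/-- `𝓢_b = lim_k ℤ[1/b][q] / ((q;q)_k)`. It depends only on `|b|`. -/
abbrev SRing (b : ℤ) : Subring (∀ k : ℕ, (ZInv b)[X] ⧸ Ideal.span {qPoch (ZInv b) k}) :=
  invLimit (qPoch (ZInv b)) (qPoch_dvd (ZInv b))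

/-- The natural map `𝓢_b → 𝓡_b`, induced by the identity of `ℤ[1/b][q]`; it exists because
`(q;q^2)_k` divides `(q;q)_{2k}`. -/
def sToR (b : ℤ) : SRing b →+* RRing b :=
  RingHom.codRestrict
    (RingHom.pi fun k : ℕ =>
      ((Ideal.Quotient.factor
          (Ideal.span_singleton_le_span_singleton.2 (qPochOdd_dvd_qPoch (ZInv b) k))).comp
        (Pi.evalRingHom _ (2 * k))).comp (SRing b).subtype)
    (RRing b)
    (by
      intro x k m h
      have hx := x.2 (2 * k) (2 * m) (by omega)
      obtain ⟨y, hy⟩ := Ideal.Quotient.mk_surjective (x.1 (2 * m))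
      simp only [RingHom.pi_apply, RingHom.comp_apply, Subring.subtype_apply,
        Pi.evalRingHom_apply]
      rw [← hx, ← hy]
      simp only [Ideal.Quotient.factor_mk])

theorem aeval_qPochOdd {b : ℤ} {ξ : ℂ} {r : ℕ} (hξ : IsPrimitiveRoot ξ r) (hr : Odd r) :
    aeval ξ (qPochOdd (ZInv b) r) = 0 := by
  obtain ⟨m, rfl⟩ := hr
  rw [qPochOdd, map_prod]
  apply Finset.prod_eq_zero (i := m) (Finset.mem_range.2 (by omega))
  simp [hξ.pow_eq_one]

/-- Evaluation `ev_ξ : 𝓡_b → ℂ` at a root of unity `ξ` of odd order `r`. As `(q;q^2)_k` vanishes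
at `ξ` for `2k > r`, the residue class at the index `k = r` has a well-defined value at `ξ`. -/
def evR (b : ℤ) {ξ : ℂ} {r : ℕ} (hξ : IsPrimitiveRoot ξ r) (hr : Odd r) : RRing b →+* ℂ :=
  (Ideal.Quotient.lift (Ideal.span {qPochOdd (ZInv b) r}) (aeval ξ : (ZInv b)[X] →ₐ[ZInv b] ℂ).toRingHom
    (by
      intro a ha
      obtain ⟨c, rfl⟩ := Ideal.mem_span_singleton.1 ha
      have h0 := aeval_qPochOdd (b := b) hξ hr
      simp [h0])).comp
    ((Pi.evalRingHom _ r).comp (RRing b).subtype)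

/-! ### Functions of `q` and evaluation at roots of unity -/

/-- The variable `q` of the field `ℚ(q)` of rational functions. -/
abbrev q : RatFunc ℚ := RatFunc.X

/-- The value at `q = ξ` of a rational function (in lowest terms). It is applied below only to
Laurent polynomials in `q`. -/
def ev (ξ : ℂ) (f : RatFunc ℚ) : ℂ := f.eval (algebraMap ℚ ℂ) ξ

/-- `∑_n^ξ f`: the sum of `ev_ξ f(q;n)` over the odd `n` with `0 < n < 2r`, where `ξ` has
order `r`. -/
def oddSum (ξ : ℂ) (r : ℕ) (f : ℕ → RatFunc ℚ) : ℂ :=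
  ∑ n ∈ (Finset.Ioo 0 (2 * r)).filter Odd, ev ξ (f n)

/-- `A(n,k) = ∏_{i=0}^k (q^n + q^{-n} - q^i - q^{-i}) / ((1-q) (q^{k+1};q)_{k+1})`. -/
def A (n k : ℕ) : RatFunc ℚ :=
  (∏ i ∈ Finset.range (k + 1),
      (q ^ (n : ℤ) + q ^ (-(n : ℤ)) - q ^ (i : ℤ) - q ^ (-(i : ℤ)))) /
    ((1 - q) * ∏ j ∈ Finset.range (k + 1), (1 - q ^ (k + 1) * q ^ j))

/-- The framing factor `q^{b(n^2-1)/4}`, for odd `n` (then `4 ∣ n^2 - 1`). -/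
def framing (b : ℤ) (n : ℕ) : RatFunc ℚ := q ^ (b * (((n : ℤ) ^ 2 - 1) / 4))

/-- The quantum integer `[n] = (q^{n/2} - q^{-n/2}) / (q^{1/2} - q^{-1/2})` for odd `n`,
written without fractional powers as `q^{-(n-1)/2} (1 - q^n) / (1 - q)`. -/
def quantumInt (n : ℕ) : RatFunc ℚ := q ^ (-(((n : ℤ) - 1) / 2)) * ((1 - q ^ n) / (1 - q))

/-- The colored Jones polynomial `J_{U^b}(n) = q^{b(n^2-1)/4} [n]` of the unknot with framing `b`,
for an odd color `n`. -/
def jonesUnknot (b : ℤ) (n : ℕ) : RatFunc ℚ := framing b n * quantumInt n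

/-- `F_{U^b}(ξ) = ∑_n^ξ [n] J_{U^b}(n)` for `ξ` of order `r`. -/
def FUnknot (b : ℤ) (ξ : ℂ) (r : ℕ) : ℂ :=
  oddSum ξ r fun n => quantumInt n * jonesUnknot b n

end

end LaplaceTransform

/-!
At a root of unity `ξ` of odd order `r`, completing the square shows that the sum over odd colors
of `q^{b(n²-1)/4} q^{na}` is a Gauss sum times the value of `q^{-a²/b}` (zero when `b d ≡ a` has
no solution modulo `r`). The Gauss sum is nonzero and cancels in the quotient, which leaves, up to
normalization, the linear map `x^a ↦ q^{-a²/b}` with `x = q^n`; this map also makes sense on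
expansions at `q = ξ e^h`. Iterating the Bailey lemma makes the image of the numerator of `A(n, k)`
divisible by `(q;q)_{2k+1}` when the exponents `a²` are scaled by integers in place of `-1/b`; since
the coefficients in `h` are polynomials in the scaling factor, divisibility persists for `-1/b`.

For roots of unity whose order has a fixed greatest common divisor with `b`, these expansions are
given to any precision by polynomials over `ℤ[1/b]`. As the primes dividing `b` are invertible,
the finitely many classes of orders do not interact, and the polynomials glue to a single element
of the completion.
-/

namespace LaplaceTransform

noncomputable section

open Finset
open scoped PowerSeries

/-! ### Gaussian binomials and the Bailey lemma -/

/-- The value `(u;u)_n = (1-u)(1-u^2)⋯(1-u^n)` of `qPoch` at an element `u` of a ring. -/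
def qPochAt {R : Type*} [CommRing R] (u : R) (n : ℕ) : R :=
  ∏ j ∈ range n, (1 - u ^ (j + 1))

section CommRing

variable {R S : Type*} [CommRing R] [CommRing S]

@[simp] theorem qPochAt_zero (u : R) : qPochAt u 0 = 1 := rfl

theorem qPochAt_succ (u : R) (n : ℕ) : qPochAt u (n + 1) = qPochAt u n * (1 - u ^ (n + 1)) :=
  prod_range_succ _ _

theorem map_qPochAt (f : R →+* S) (u : R) (n : ℕ) : f (qPochAt u n) = qPochAt (f u) n := by
  simp [qPochAt]

theorem qPochAt_mul_prod_Ico (u : R) {i n : ℕ} (h : i ≤ n) :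
    qPochAt u i * ∏ l ∈ Ico i n, (1 - u ^ (l + 1)) = qPochAt u n := by
  simpa only [qPochAt, range_eq_Ico] using prod_Ico_consecutive _ (Nat.zero_le i) h

theorem qPochAt_ne_zero_of_le {u : R} {i n : ℕ} (hn : qPochAt u n ≠ 0) (h : i ≤ n) :
    qPochAt u i ≠ 0 :=
  left_ne_zero_of_mul ((qPochAt_mul_prod_Ico u h).trans_ne hn)

theorem one_sub_pow_ne_zero {u : R} {i n : ℕ} (hn : qPochAt u n ≠ 0) (h : i < n) :
    1 - u ^ (i + 1) ≠ 0 :=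
  right_ne_zero_of_mul ((qPochAt_succ u i).symm.trans_ne (qPochAt_ne_zero_of_le hn h))

theorem sum_range_add_shift {f g h : ℕ → R} (n : ℕ) (h_zero : f 0 = g 0)
    (h_succ : ∀ i ≤ n, f (i + 1) = g (i + 1) + h i) (h_top : g (n + 1) = 0) :
    ∑ i ∈ range (n + 2), f i = ∑ i ∈ range (n + 1), (g i + h i) := by
  have hg : ∑ i ∈ range (n + 1), g (i + 1) + g 0 = ∑ i ∈ range (n + 1), g i := by
    rw [← sum_range_succ', sum_range_succ, h_top, add_zero]
  rw [sum_range_succ', h_zero,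
    sum_congr rfl fun i hi => h_succ i (mem_range_succ_iff.1 hi),
    sum_add_distrib, sum_add_distrib, ← hg]
  ring

end CommRing

section Field

variable {F : Type*} [Field F] {u : F}

/-- The Gaussian binomial coefficient `x` over `n` in base `u`, with an arbitrary integer `x` on
top. -/
def gaussBinom (u : F) (x : ℤ) (n : ℕ) : F :=
  (∏ l ∈ range n, (1 - u ^ (x - (l : ℤ)))) / qPochAt u n

@[simp] theorem gaussBinom_zero_right (u : F) (x : ℤ) : gaussBinom u x 0 = 1 := by
  simp [gaussBinom]

theorem gaussBinom_natCast_eq_zero (u : F) {m n : ℕ} (h : m < n) :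
    gaussBinom u (m : ℤ) n = 0 := by
  rw [gaussBinom, prod_eq_zero (mem_range.2 h) (by simp), zero_div]

theorem prod_one_sub_zpow_succ (u : F) (x : ℤ) (n : ℕ) :
    ∏ l ∈ range (n + 1), (1 - u ^ (x + 1 - (l : ℤ)))
      = (1 - u ^ (x + 1)) * ∏ l ∈ range n, (1 - u ^ (x - (l : ℤ))) := by
  rw [prod_range_succ', mul_comm]
  simp [add_sub_add_right_eq_sub]

theorem zpow_add_one_eq_mul (hu : u ≠ 0) (x : ℤ) (n : ℕ) :
    u ^ (x + 1) = u ^ (x - (n : ℤ)) * u ^ (n + 1) := by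
  rw [← zpow_natCast u (n + 1), ← zpow_add₀ hu]
  push_cast
  ring_nf

theorem gaussBinom_pascal (hu : u ≠ 0) (x : ℤ) {n : ℕ} (hn : qPochAt u (n + 1) ≠ 0) :
    gaussBinom u (x + 1) (n + 1)
      = gaussBinom u x (n + 1) + u ^ (x - (n : ℤ)) * gaussBinom u x n := by
  have h₁ := qPochAt_ne_zero_of_le hn n.le_succ
  have h₂ := one_sub_pow_ne_zero hn n.lt_succ_self
  rw [gaussBinom, gaussBinom, gaussBinom, prod_one_sub_zpow_succ, prod_range_succ, qPochAt_succ,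
    zpow_add_one_eq_mul hu x n]
  field_simp
  ring

theorem gaussBinom_pascal' (hu : u ≠ 0) (x : ℤ) {n : ℕ} (hn : qPochAt u (n + 1) ≠ 0) :
    gaussBinom u (x + 1) (n + 1)
      = u ^ (n + 1) * gaussBinom u x (n + 1) + gaussBinom u x n := by
  have h₁ := qPochAt_ne_zero_of_le hn n.le_succ
  have h₂ := one_sub_pow_ne_zero hn n.lt_succ_self
  rw [gaussBinom, gaussBinom, gaussBinom, prod_one_sub_zpow_succ, prod_range_succ, qPochAt_succ,
    zpow_add_one_eq_mul hu x n]
  field_simp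
  ring

theorem gaussBinom_natCast {n i : ℕ} (hn : qPochAt u n ≠ 0) (h : i ≤ n) :
    gaussBinom u (n : ℤ) i = qPochAt u n / (qPochAt u i * qPochAt u (n - i)) := by
  have h₁ := qPochAt_ne_zero_of_le hn h
  have h₂ := qPochAt_ne_zero_of_le hn (n.sub_le i)
  have h_num : ∏ l ∈ range i, (1 - u ^ ((n : ℤ) - (l : ℤ)))
      = ∏ l ∈ Ico (n - i) n, (1 - u ^ (l + 1)) := by
    rw [prod_Ico_eq_prod_range, Nat.sub_sub_self h, ← prod_range_reflect]
    refine prod_congr rfl fun l hl => ?_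
    have := mem_range.1 hl
    rw [← zpow_natCast]
    congr 2
    lia
  rw [gaussBinom, h_num, ← qPochAt_mul_prod_Ico u (n.sub_le i)]
  field_simp

theorem gaussBinom_mem (hu : u ≠ 0) (hroot : ∀ n, qPochAt u n ≠ 0) (B : Subring F)
    (hB : ∀ x : ℤ, u ^ x ∈ B) (n : ℕ) (x : ℤ) : gaussBinom u x n ∈ B := by
  induction n generalizing x with
  | zero => simp [B.one_mem]
  | succ n ih =>
    induction x with
    | zero =>
      have h := gaussBinom_natCast_eq_zero u n.succ_pos
      rw [Nat.cast_zero] at h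
      exact h ▸ B.zero_mem
    | succ x hx =>
      rw [gaussBinom_pascal hu _ (hroot _)]
      exact B.add_mem hx (B.mul_mem (hB _) (ih _))
    | pred x hx =>
      have h := gaussBinom_pascal hu (-(x : ℤ) - 1) (hroot (n + 1))
      rw [sub_add_cancel] at h
      rw [eq_sub_of_add_eq h.symm]
      exact B.sub_mem hx (B.mul_mem (hB _) (ih _))

theorem prod_one_sub_mul_pow_eq_sum_gaussBinom (hu : u ≠ 0) (x : F) (n : ℕ) (hn : qPochAt u n ≠ 0) :
    ∏ l ∈ range n, (1 - x * u ^ l)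
      = ∑ i ∈ range (n + 1), (-1) ^ i * u ^ (i.choose 2) * gaussBinom u (n : ℤ) i * x ^ i := by
  induction n with
  | zero => simp
  | succ n ih =>
    rw [prod_range_succ, ih (qPochAt_ne_zero_of_le hn n.le_succ), sum_mul]
    symm
    rw [sum_range_add_shift
      (g := fun i => (-1) ^ i * u ^ (i.choose 2) * gaussBinom u (n : ℤ) i * x ^ i)
      (h := fun i => -((-1) ^ i * u ^ (i.choose 2) * gaussBinom u (n : ℤ) i * x ^ i * (x * u ^ n)))]
    · exact sum_congr rfl fun i _ => by ring
    · simp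
    · intro i hi
      have h_choose : (i + 1).choose 2 = i + i.choose 2 := by
        rw [Nat.choose_succ_succ' i 1, Nat.choose_one_right]
      have h_pow : u ^ n = u ^ ((n : ℤ) - (i : ℤ)) * u ^ i := by
        rw [← zpow_natCast u i, ← zpow_add₀ hu, sub_add_cancel, zpow_natCast]
      rw [Nat.cast_succ, gaussBinom_pascal hu _ (qPochAt_ne_zero_of_le hn (by lia)), h_choose,
        h_pow]
      ring
    · simp [gaussBinom_natCast_eq_zero]

theorem sum_gaussBinom_mul_prod_Ico (hu : u ≠ 0) (n : ℕ) (hn : qPochAt u n ≠ 0) (x : F) :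
    ∑ i ∈ range (n + 1), u ^ (i ^ 2) * x ^ i * gaussBinom u (n : ℤ) i
      * ∏ l ∈ Ico i n, (1 - x * u ^ (l + 1)) = 1 := by
  induction n generalizing x with
  | zero => simp
  | succ n ih =>
    refine Eq.trans ?_ (ih (qPochAt_ne_zero_of_le hn n.le_succ) (x * u))
    rw [sum_range_add_shift
      (g := fun i => u ^ (i ^ 2) * (x * u) ^ i * gaussBinom u (n : ℤ) i
        * ∏ l ∈ Ico i (n + 1), (1 - x * u ^ (l + 1)))
      (h := fun i => u ^ ((i + 1) ^ 2) * x ^ (i + 1) * gaussBinom u (n : ℤ) i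
        * ∏ l ∈ Ico (i + 1) (n + 1), (1 - x * u ^ (l + 1)))]
    · refine sum_congr rfl fun i hi => ?_
      have h_shift : ∏ l ∈ Ico (i + 1) (n + 1), (1 - x * u ^ (l + 1))
          = ∏ l ∈ Ico i n, (1 - x * u * u ^ (l + 1)) := by
        rw [← prod_Ico_add' _ i n 1]
        exact prod_congr rfl fun l _ => by ring
      rw [prod_eq_prod_Ico_succ_bot (mem_range.1 hi), h_shift]
      ring
    · simp
    · intro i hi
      rw [Nat.cast_succ, gaussBinom_pascal' hu _ (qPochAt_ne_zero_of_le hn (by lia))]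
      ring
    · simp [gaussBinom_natCast_eq_zero]

theorem qPochAt_mul_prod_Ico_shift (u : F) {i n : ℕ} (h : i ≤ n) (m : ℕ) :
    qPochAt u (m + i) * ∏ l ∈ Ico i n, (1 - u ^ m * u ^ (l + 1)) = qPochAt u (m + n) := by
  rw [← qPochAt_mul_prod_Ico u (Nat.add_le_add_left h m), add_comm m, add_comm m,
    ← prod_Ico_add' _ i n m]
  exact congrArg _ (prod_congr rfl fun l _ => by ring)

theorem sum_Ico_bailey (hu : u ≠ 0) (hroot : ∀ n, qPochAt u n ≠ 0) {a k : ℕ} (h : a ≤ k) :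
    ∑ j ∈ Ico a (k + 1),
        u ^ (j ^ 2 + j) / (qPochAt u (k - j) * (qPochAt u (j - a) * qPochAt u (j + 1 + a)))
      = u ^ (a ^ 2 + a) / (qPochAt u (k - a) * qPochAt u (k + 1 + a)) := by
  obtain ⟨n, rfl⟩ := Nat.exists_eq_add_of_le h
  rw [sum_Ico_eq_sum_range, show a + n + 1 - a = n + 1 by lia, show a + n - a = n by lia,
    ← mul_one (u ^ (a ^ 2 + a)),
    ← sum_gaussBinom_mul_prod_Ico hu n (hroot n) (u ^ (2 * a + 1)), mul_sum, sum_div]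
  refine sum_congr rfl fun i hi => ?_
  have hi' : i ≤ n := mem_range_succ_iff.1 hi
  have h_prod := qPochAt_mul_prod_Ico_shift u hi' (2 * a + 1)
  have h₁ := hroot (2 * a + 1 + i)
  have h₂ := right_ne_zero_of_mul (h_prod.trans_ne (hroot _))
  have h₃ := hroot i
  have h₄ := hroot (n - i)
  have h₅ := hroot n
  rw [gaussBinom_natCast (hroot n) hi', show a + n - (a + i) = n - i by lia,
    show a + i - a = i by lia, show a + i + 1 + a = 2 * a + 1 + i by ring,
    show a + n + 1 + a = 2 * a + 1 + n by ring, ← h_prod]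
  field_simp
  ring

/-- The sum `∑_a α_a / ((u;u)_{k-a} (u;u)_{k+1+a})`: if `β_k` denotes it, then `(α, β)` is a
Bailey pair relative to `u`, up to a factor `1 - u` in the normalization of `β`. -/
def baileySum (u : F) (α : ℕ → F) (k : ℕ) : F :=
  ∑ a ∈ range (k + 1), α a / (qPochAt u (k - a) * qPochAt u (k + 1 + a))

theorem bailey_lemma (hu : u ≠ 0) (hroot : ∀ n, qPochAt u n ≠ 0) (α : ℕ → F) (k : ℕ) :
    baileySum u (fun a => α a * u ^ (a ^ 2 + a)) k
      = ∑ j ∈ range (k + 1), u ^ (j ^ 2 + j) / qPochAt u (k - j) * baileySum u α j := by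
  simp_rw [baileySum, mul_sum]
  rw [sum_comm' (t' := range (k + 1)) (s' := fun a => Ico a (k + 1))
    (by simp only [mem_range, mem_Ico]; lia)]
  refine sum_congr rfl fun a ha => ?_
  rw [mul_div_assoc, ← sum_Ico_bailey hu hroot (mem_range_succ_iff.1 ha), mul_sum]
  refine sum_congr rfl fun j _ => ?_
  rw [div_mul_div_comm, mul_comm (α a), div_mul_eq_mul_div]

/-- The summand `(-1)^a u^{a(a+1)/2} (x^a - x^{-1-a})`, which pairs the two terms of the
`q`-binomial theorem for `2k+1` factors exchanged by `a ↦ -1-a`. -/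
def foldedTerm (u x : F) (a : ℕ) : F :=
  (-1) ^ a * u ^ ((a + 1).choose 2) * (x ^ (a : ℤ) - x ^ (-1 - (a : ℤ)))

theorem two_mul_choose_two (n : ℕ) : (2 * n.choose 2 : ℤ) = n * (n - 1) := by
  have h : ((2 * n.choose 2 : ℤ) : ℚ) = ((n * (n - 1) : ℤ) : ℚ) := by
    push_cast [Nat.cast_choose_two]
    ring
  exact_mod_cast h

theorem qBinomial_term_eq_of_two_mul (hu : u ≠ 0) {x : F} (hx : x ≠ 0) (k i : ℕ) {e : ℕ}
    (he : (2 * e : ℤ) = (i - k - 1) * (i - k)) :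
    (-1) ^ (k + 1) * u ^ ((k + 1).choose 2) * x ^ (-1 - (k : ℤ))
        * ((-1) ^ i * u ^ (i.choose 2) * (x * u ^ (-(k : ℤ))) ^ i)
      = (-1) ^ (k + 1 + i) * u ^ e * x ^ ((i : ℤ) - k - 1) := by
  have hu_exp : u ^ ((k + 1).choose 2) * u ^ (i.choose 2) * (u ^ (-(k : ℤ))) ^ i = u ^ e := by
    simp only [← zpow_natCast, ← zpow_mul, ← zpow_add₀ hu]
    have h₁ := two_mul_choose_two (k + 1)
    have h₂ := two_mul_choose_two i
    push_cast at h₁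
    congr 1
    linarith
  have hx_exp : x ^ (-1 - (k : ℤ)) * x ^ i = x ^ ((i : ℤ) - k - 1) := by
    rw [← zpow_natCast x i, ← zpow_add₀ hx]
    ring_nf
  rw [← hu_exp, ← hx_exp, mul_pow, pow_add]
  ring

theorem qBinomial_terms_add (hu : u ≠ 0) {x : F} (hx : x ≠ 0) {a k : ℕ} (ha : a ≤ k) :
    (-1) ^ (k + 1) * u ^ ((k + 1).choose 2) * x ^ (-1 - (k : ℤ))
        * ((-1) ^ (k - a) * u ^ ((k - a).choose 2) * (x * u ^ (-(k : ℤ))) ^ (k - a)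
          + (-1) ^ (k + 1 + a) * u ^ ((k + 1 + a).choose 2)
            * (x * u ^ (-(k : ℤ))) ^ (k + 1 + a))
      = foldedTerm u x a := by
  obtain ⟨d, rfl⟩ := Nat.exists_eq_add_of_le ha
  rw [mul_add,
    qBinomial_term_eq_of_two_mul hu hx _ _ (e := (a + 1).choose 2) (by
      rw [two_mul_choose_two]; push_cast [Nat.add_sub_cancel_left]; ring),
    qBinomial_term_eq_of_two_mul hu hx _ _ (e := (a + 1).choose 2) (by
      rw [two_mul_choose_two]; push_cast; ring),
    foldedTerm]
  have h_sign₁ : (-1 : F) ^ (a + d + 1 + (a + d - a)) = -(-1) ^ a := by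
    rw [Nat.add_sub_cancel_left, show a + d + 1 + d = 2 * d + (a + 1) by ring, pow_add, pow_mul]
    simp [pow_succ]
  have h_sign₂ : (-1 : F) ^ (a + d + 1 + (a + d + 1 + a)) = (-1) ^ a := by
    rw [show a + d + 1 + (a + d + 1 + a) = 2 * (a + d + 1) + a by ring, pow_add, pow_mul]
    simp
  rw [h_sign₁, h_sign₂, show ((a + d - a : ℕ) : ℤ) - (a + d : ℕ) - 1 = -1 - a by
      push_cast [Nat.add_sub_cancel_left]; ring,
    show ((a + d + 1 + a : ℕ) : ℤ) - (a + d : ℕ) - 1 = a by push_cast; ring]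
  ring

theorem baileySum_foldedTerm (hu : u ≠ 0) {x : F} (hx : x ≠ 0) (k : ℕ)
    (hk : qPochAt u (2 * k + 1) ≠ 0) :
    baileySum u (foldedTerm u x) k
      = (-1) ^ (k + 1) * u ^ ((k + 1).choose 2) * x ^ (-1 - (k : ℤ))
        * ((∏ l ∈ range (2 * k + 1), (1 - x * u ^ (-(k : ℤ)) * u ^ l))
          / qPochAt u (2 * k + 1)) := by
  let t : ℕ → F := fun i =>
    (-1) ^ i * u ^ (i.choose 2) * gaussBinom u ((2 * k + 1 : ℕ) : ℤ) i * (x * u ^ (-(k : ℤ))) ^ i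
  have h_fold : ∑ i ∈ range (2 * k + 1 + 1), t i
      = ∑ a ∈ range (k + 1), (t (k - a) + t (k + 1 + a)) := by
    rw [show 2 * k + 1 + 1 = (k + 1) + (k + 1) by ring, sum_range_add, ← sum_range_reflect,
      ← sum_add_distrib]
    simp only [Nat.add_sub_cancel]
  rw [prod_one_sub_mul_pow_eq_sum_gaussBinom hu _ _ hk, h_fold, sum_div, mul_sum, baileySum]
  refine sum_congr rfl fun a ha => ?_
  have ha' : a ≤ k := mem_range_succ_iff.1 ha
  have h₁ := qPochAt_ne_zero_of_le hk (show k - a ≤ 2 * k + 1 by lia)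
  have h₂ := qPochAt_ne_zero_of_le hk (show k + 1 + a ≤ 2 * k + 1 by lia)
  simp only [t]
  rw [← qBinomial_terms_add hu hx ha', gaussBinom_natCast hk (by lia),
    gaussBinom_natCast hk (by lia), show 2 * k + 1 - (k - a) = k + 1 + a by lia,
    show 2 * k + 1 - (k + 1 + a) = k - a by lia]
  field_simp

theorem qPochAt_mul_baileySum_mem (hu : u ≠ 0) (hroot : ∀ n, qPochAt u n ≠ 0) (B : Subring F)
    (hB : ∀ x : ℤ, u ^ x ∈ B) (s : ℤ) (m k : ℕ) :
    qPochAt u k * baileySum u (fun a => foldedTerm u (u ^ s) a * (u ^ (a ^ 2 + a)) ^ m) k ∈ B := by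
  have hB' : ∀ n : ℕ, u ^ n ∈ B := fun n => by simpa using hB n
  induction m generalizing k with
  | zero =>
    have h_binom : (∏ l ∈ range (2 * k + 1), (1 - u ^ s * u ^ (-(k : ℤ)) * u ^ l))
        / qPochAt u (2 * k + 1) = gaussBinom u (s + k) (2 * k + 1) := by
      rw [gaussBinom, ← prod_range_reflect]
      refine congrArg (· / _) (prod_congr rfl fun l hl => ?_)
      have := mem_range.1 hl
      rw [← zpow_natCast, ← zpow_add₀ hu, ← zpow_add₀ hu]
      congr 2
      lia
    simp only [pow_zero, mul_one]
    rw [baileySum_foldedTerm hu (zpow_ne_zero s hu) k (hroot _), ← zpow_mul, h_binom]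
    refine B.mul_mem (B.prod_mem fun j _ => B.sub_mem B.one_mem (hB' _)) (B.mul_mem
      (B.mul_mem (B.mul_mem (B.pow_mem (B.neg_mem B.one_mem) _) (hB' _)) (hB _))
      (gaussBinom_mem hu hroot B hB _ _))
  | succ m ih =>
    simp_rw [pow_succ _ m, ← mul_assoc]
    rw [bailey_lemma hu hroot, mul_sum]
    refine B.sum_mem fun j hj => ?_
    have h_term : qPochAt u k * (u ^ (j ^ 2 + j) / qPochAt u (k - j) * baileySum u
          (fun a => foldedTerm u (u ^ s) a * (u ^ (a ^ 2 + a)) ^ m) j)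
        = gaussBinom u k j * u ^ (j ^ 2 + j) * (qPochAt u j * baileySum u
          (fun a => foldedTerm u (u ^ s) a * (u ^ (a ^ 2 + a)) ^ m) j) := by
      rw [gaussBinom_natCast (hroot k) (mem_range_succ_iff.1 hj)]
      have h₁ := hroot j
      have h₂ := hroot (k - j)
      field_simp
    rw [h_term]
    exact B.mul_mem (B.mul_mem (gaussBinom_mem hu hroot B hB j k) (hB' _)) (ih j)

end Field

/-! ### Expansions at a root of unity -/

/-- `∑_{a=0}^k (-1)^a u^{a(a+1)/2} (G(a) - G(-1-a)) (u;u)_k / ((u;u)_{k-a} (u;u)_{k+1+a})`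
multiplied by `(u;u)_{2k+1}`, so that it is defined over any ring. -/
def foldedSum {R : Type*} [CommRing R] (u : R) (k : ℕ) (G : ℤ → R) : R :=
  ∑ a ∈ range (k + 1), (-1) ^ a * u ^ ((a + 1).choose 2)
    * (∏ l ∈ Ico (k - a) k, (1 - u ^ (l + 1)))
    * (∏ l ∈ Ico (k + 1 + a) (2 * k + 1), (1 - u ^ (l + 1))) * (G a - G (-1 - a))

section FoldedSum

variable {R S : Type*} [CommRing R] [CommRing S]

theorem map_foldedSum (f : R →+* S) (u : R) (k : ℕ) (G : ℤ → R) :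
    f (foldedSum u k G) = foldedSum (f u) k fun a => f (G a) := by
  simp [foldedSum]

theorem foldedSum_sum_mul {ι : Type*} (s : Finset ι) (u : R) (k : ℕ) (c : ι → R)
    (G : ι → ℤ → R) :
    foldedSum u k (fun a => ∑ n ∈ s, c n * G n a) = ∑ n ∈ s, c n * foldedSum u k (G n) := by
  simp_rw [foldedSum, mul_sum]
  rw [sum_comm]
  refine sum_congr rfl fun a _ => ?_
  rw [← sum_sub_distrib, mul_sum]
  exact sum_congr rfl fun n _ => by ring

theorem foldedSum_eq_baileySum {F : Type*} [Field F] {u : F} {k : ℕ}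
    (hk : qPochAt u (2 * k + 1) ≠ 0) (G : ℤ → F) :
    foldedSum u k G = qPochAt u (2 * k + 1) * (qPochAt u k * baileySum u
      (fun a => (-1) ^ a * u ^ ((a + 1).choose 2) * (G a - G (-1 - a))) k) := by
  simp_rw [foldedSum, baileySum, mul_sum]
  refine sum_congr rfl fun a ha => ?_
  have ha' : a ≤ k := mem_range_succ_iff.1 ha
  have h₁ := qPochAt_ne_zero_of_le hk (show k - a ≤ 2 * k + 1 by lia)
  have h₂ := qPochAt_ne_zero_of_le hk (show k + 1 + a ≤ 2 * k + 1 by lia)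
  rw [← qPochAt_mul_prod_Ico u (k.sub_le a),
    ← qPochAt_mul_prod_Ico u (show k + 1 + a ≤ 2 * k + 1 by lia)]
  field_simp

end FoldedSum

section Expansion

variable {K : Type*} [Field K] [CharZero K]

/-- The power series `e^{xh}`, where `h` is the variable. -/
def pexp (x : K) : K⟦X⟧ := PowerSeries.rescale x (PowerSeries.exp K)

theorem pexp_add (x y : K) : pexp (x + y) = pexp x * pexp y :=
  (PowerSeries.exp_mul_exp_eq_exp_add x y).symm

@[simp] theorem coeff_pexp (x : K) (n : ℕ) :
    PowerSeries.coeff n (pexp x) = x ^ n * (n.factorial : K)⁻¹ := by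
  simp [pexp, PowerSeries.coeff_rescale, PowerSeries.coeff_exp]

@[simp] theorem constantCoeff_pexp (x : K) : PowerSeries.constantCoeff (pexp x) = 1 := by
  simp [← PowerSeries.coeff_zero_eq_constantCoeff_apply]

@[simp] theorem pexp_zero : pexp (0 : K) = 1 := by
  simp [pexp, PowerSeries.rescale_zero]

theorem pexp_pow (x : K) (n : ℕ) : pexp x ^ n = pexp (n * x) := by
  induction n with
  | zero => simp
  | succ n ih => rw [pow_succ, ih, ← pexp_add, Nat.cast_succ, add_one_mul]

theorem pexp_ne_one {x : K} (hx : x ≠ 0) : pexp x ≠ 1 := fun h =>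
  hx (by simpa [PowerSeries.coeff_one] using congrArg (PowerSeries.coeff 1) h)

/-- The expansion `ξ e^h` of the variable `q` at `q = ξ`. -/
def localVar (ξ : K) : K⟦X⟧ := PowerSeries.C ξ * pexp 1

/-- The expansion `(ξ e^h)^x` of `q^x` at `q = ξ`, for an integer `x`. -/
def localPow (ξ : K) (x : ℤ) : K⟦X⟧ := PowerSeries.C (ξ ^ x) * pexp (x : K)

theorem localPow_add {ξ : K} (hξ : ξ ≠ 0) (x y : ℤ) :
    localPow ξ (x + y) = localPow ξ x * localPow ξ y := by
  rw [localPow, zpow_add₀ hξ, Int.cast_add, pexp_add, map_mul, localPow, localPow]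
  ring

@[simp] theorem localPow_zero (ξ : K) : localPow ξ 0 = 1 := by simp [localPow]

theorem localPow_mul_localPow_neg {ξ : K} (hξ : ξ ≠ 0) (x : ℤ) :
    localPow ξ x * localPow ξ (-x) = 1 := by
  rw [← localPow_add hξ, add_neg_cancel, localPow_zero]

theorem localVar_pow (ξ : K) (n : ℕ) : localVar ξ ^ n = PowerSeries.C (ξ ^ n) * pexp (n : K) := by
  rw [localVar, mul_pow, pexp_pow, mul_one, map_pow]

theorem localVar_pow_eq_localPow (ξ : K) (n : ℕ) : localVar ξ ^ n = localPow ξ n := by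
  simp [localVar_pow, localPow]

@[simp] theorem constantCoeff_localVar (ξ : K) : PowerSeries.constantCoeff (localVar ξ) = ξ := by
  simp [localVar]

theorem localVar_pow_ne_one (ξ : K) {n : ℕ} (hn : n ≠ 0) : localVar ξ ^ n ≠ 1 := by
  intro h
  have h_const : ξ ^ n = 1 := by simpa using congrArg PowerSeries.constantCoeff h
  rw [localVar_pow, h_const, map_one, one_mul] at h
  exact pexp_ne_one (Nat.cast_ne_zero.2 hn) h

theorem qPochAt_localVar_ne_zero (ξ : K) (n : ℕ) : qPochAt (localVar ξ) n ≠ 0 :=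
  prod_ne_zero_iff.2 fun j _ => sub_ne_zero.2 (localVar_pow_ne_one ξ j.succ_ne_zero).symm

theorem map_localPow_eq_zpow {F : Type*} [Field F] (f : K⟦X⟧ →+* F) {ξ : K} (hξ : ξ ≠ 0) (x : ℤ) :
    f (localPow ξ x) = f (localVar ξ) ^ x := by
  have h_nat (n : ℕ) : f (localPow ξ n) = f (localVar ξ) ^ n := by
    rw [← localVar_pow_eq_localPow, map_pow]
  obtain ⟨n, rfl | rfl⟩ := x.eq_nat_or_neg
  · rw [h_nat, zpow_natCast]
  · rw [zpow_neg, zpow_natCast, ← h_nat]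
    refine eq_inv_of_mul_eq_one_right ?_
    rw [← map_mul, localPow_mul_localPow_neg hξ, map_one]

end Expansion

section PolyDep

variable {K : Type*} [Field K]

/-- A family of power series whose coefficients are polynomials in the parameter. -/
def PolyDep (f : K → K⟦X⟧) : Prop :=
  ∀ i, ∃ p : K[X], ∀ z, PowerSeries.coeff i (f z) = p.eval z

namespace PolyDep

theorem const (g : K⟦X⟧) : PolyDep fun _ => g :=
  fun i => ⟨C (PowerSeries.coeff i g), fun z => by simp⟩

theorem sub {f g : K → K⟦X⟧} (hf : PolyDep f) (hg : PolyDep g) : PolyDep fun z => f z - g z :=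
  fun i =>
    let ⟨p, hp⟩ := hf i
    let ⟨s, hs⟩ := hg i
    ⟨p - s, fun z => by simp [hp, hs]⟩

theorem mul {f g : K → K⟦X⟧} (hf : PolyDep f) (hg : PolyDep g) : PolyDep fun z => f z * g z := by
  intro i
  choose p hp using hf
  choose s hs using hg
  exact ⟨∑ ij ∈ antidiagonal i, p ij.1 * s ij.2,
    fun z => by simp [PowerSeries.coeff_mul, hp, hs, eval_finsetSum]⟩

theorem sum {ι : Type*} (s : Finset ι) {f : ι → K → K⟦X⟧} (hf : ∀ i, PolyDep (f i)) :
    PolyDep fun z => ∑ i ∈ s, f i z := by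
  intro n
  choose p hp using fun i => hf i n
  exact ⟨∑ i ∈ s, p i, fun z => by simp [hp, eval_finsetSum]⟩

theorem foldedSum (u : K⟦X⟧) (k : ℕ) {G : K → ℤ → K⟦X⟧} (hG : ∀ a, PolyDep fun z => G z a) :
    PolyDep fun z => foldedSum u k (G z) :=
  sum _ fun a => (const _).mul ((hG a).sub (hG (-1 - a)))

theorem C_mul_pexp [CharZero K] (c θ ρ : K) : PolyDep fun z => PowerSeries.C c * pexp (θ * z + ρ) :=
  (const _).mul fun i => ⟨(C θ * X + C ρ) ^ i * C (i.factorial : K)⁻¹, fun z => by simp⟩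

theorem dvd_of_infinite {f : K → K⟦X⟧} (hf : PolyDep f) {D : K⟦X⟧} (hD : D ≠ 0) {S : Set K}
    (hS : S.Infinite) (h : ∀ z ∈ S, D ∣ f z) (z : K) : D ∣ f z := by
  obtain ⟨n, hn⟩ := IsDiscreteValuationRing.associated_pow_irreducible hD PowerSeries.X_irreducible
  simp only [hn.dvd_iff_dvd_left, PowerSeries.X_pow_dvd_iff] at h ⊢
  intro i hi
  obtain ⟨p, hp⟩ := hf i
  have hp_zero : p = 0 := eq_zero_of_infinite_isRoot p
    (hS.mono fun w hw => (hp w).symm.trans (h w hw i hi))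
  simp [hp, hp_zero]

end PolyDep

end PolyDep

/-! ### Divisibility by `(q;q)_{2k+1}` at a root of unity -/

section Divisibility

variable {K : Type*} [Field K] [CharZero K]

theorem qPochAt_dvd_foldedSum_localPow {ξ : K} (hξ : ξ ≠ 0) (k m : ℕ) (n : ℤ) :
    qPochAt (localVar ξ) (2 * k + 1)
      ∣ foldedSum (localVar ξ) k fun x => localPow ξ (m * x ^ 2 + n * x) := by
  let f := algebraMap K⟦X⟧ (FractionRing K⟦X⟧)
  have hf : Function.Injective f := IsFractionRing.injective _ _
  have hroot (j : ℕ) : qPochAt (f (localVar ξ)) j ≠ 0 := by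
    rw [← map_qPochAt]
    exact (map_ne_zero_iff f hf).2 (qPochAt_localVar_ne_zero ξ j)
  have hu : f (localVar ξ) ≠ 0 := (map_ne_zero_iff f hf).2 fun h =>
    hξ (by simpa using congrArg PowerSeries.constantCoeff h)
  have hz := map_localPow_eq_zpow f hξ
  obtain ⟨y, hy⟩ :=
    qPochAt_mul_baileySum_mem hu hroot f.range (fun x => ⟨_, hz x⟩) (n - m) m k
  refine ⟨y, hf ?_⟩
  rw [map_mul, hy, map_qPochAt, map_foldedSum, foldedSum_eq_baileySum (hroot _)]
  congr 3
  funext a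
  have h_pow : (f (localVar ξ) ^ (a ^ 2 + a)) ^ m = f (localVar ξ) ^ ((m : ℤ) * (a ^ 2 + a)) := by
    rw [← pow_mul, ← zpow_natCast]
    push_cast
    ring_nf
  have h_exp (x : ℤ) : m * x ^ 2 + n * x = m * (x ^ 2 + x) + (n - m) * x := by ring
  rw [foldedTerm, h_pow, ← zpow_mul, ← zpow_mul, hz, hz, h_exp, h_exp (-1 - a), zpow_add₀ hu,
    zpow_add₀ hu]
  ring_nf

theorem ne_zero_of_orderOf_pos {M : Type*} [MonoidWithZero M] [Nontrivial M] {ξ : M}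
    (hξ : 0 < orderOf ξ) : ξ ≠ 0 :=
  (orderOf_pos_iff.1 hξ).isUnit.ne_zero

theorem localPow_add_orderOf_mul {ξ : K} (hξ : 0 < orderOf ξ) (m n l x : ℤ) :
    localPow ξ (orderOf ξ * m * x ^ 2 + (n + orderOf ξ * l) * x)
      = PowerSeries.C (ξ ^ (n * x))
        * pexp ((orderOf ξ * m : ℤ) * (x : K) ^ 2 + (n + orderOf ξ * l : ℤ) * x) := by
  have h_root : ξ ^ (orderOf ξ : ℤ) = 1 := by rw [zpow_natCast, pow_orderOf_eq_one]
  have h_exp : orderOf ξ * m * x ^ 2 + (n + orderOf ξ * l) * x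
      = n * x + (orderOf ξ : ℤ) * (m * x ^ 2 + l * x) := by ring
  rw [localPow, h_exp, zpow_add₀ (ne_zero_of_orderOf_pos hξ), zpow_mul ξ (orderOf ξ : ℤ),
    h_root, one_zpow, mul_one]
  congr 2
  push_cast
  ring

/-- The exponential is an integral power of `ξ e^h` when `z` and `w - n` are multiples of the
order of `ξ`; the general case follows because both sides are polynomial in `z` and in `w`. -/
theorem qPochAt_dvd_foldedSum_zpow_mul_pexp {ξ : K} (hξ : 0 < orderOf ξ) (k : ℕ) (n : ℤ)
    (z w : K) :
    qPochAt (localVar ξ) (2 * k + 1) ∣ foldedSum (localVar ξ) k fun x =>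
      PowerSeries.C (ξ ^ (n * x)) * pexp (z * (x : K) ^ 2 + w * x) := by
  have h_infinite (d : ℤ) : (Set.range fun m : ℕ => ((d + orderOf ξ * m : ℤ) : K)).Infinite :=
    Set.infinite_range_of_injective fun m m' h => by
      have := Int.cast_injective h
      simpa [hξ.ne'] using this
  have hD := qPochAt_localVar_ne_zero ξ (2 * k + 1)
  refine PolyDep.dvd_of_infinite (f := fun w => foldedSum (localVar ξ) k fun x =>
    PowerSeries.C (ξ ^ (n * x)) * pexp (z * (x : K) ^ 2 + w * x))
    (.foldedSum _ _ fun x => ?_) hD (h_infinite n) ?_ w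
  · simpa only [mul_comm _ (x : K), add_comm (z * _)] using
      PolyDep.C_mul_pexp (ξ ^ (n * x)) (x : K) (z * (x : K) ^ 2)
  rintro _ ⟨l, rfl⟩
  refine PolyDep.dvd_of_infinite (f := fun z => foldedSum (localVar ξ) k fun x =>
    PowerSeries.C (ξ ^ (n * x)) * pexp (z * (x : K) ^ 2 + (n + orderOf ξ * l : ℤ) * x))
    (.foldedSum _ _ fun x => ?_) hD (h_infinite 0) ?_ z
  · simpa only [mul_comm _ ((x : K) ^ 2)] using
      PolyDep.C_mul_pexp (ξ ^ (n * x)) ((x : K) ^ 2) ((n + orderOf ξ * l : ℤ) * (x : K))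
  rintro _ ⟨m, rfl⟩
  have h := qPochAt_dvd_foldedSum_localPow (ne_zero_of_orderOf_pos hξ) k (orderOf ξ * m)
    (n + orderOf ξ * l)
  simpa only [Nat.cast_mul, localPow_add_orderOf_mul hξ, zero_add] using h

theorem zmodChar_intCast {K : Type*} [Field K] {r : ℕ} [NeZero r] {ξ : K} (hξ : ξ ^ r = 1) (x : ℤ) :
    AddChar.zmodChar r hξ x = ξ ^ x := by
  have h_one : AddChar.zmodChar r hξ 1 = ξ := by
    simpa using AddChar.zmodChar_apply' hξ 1
  rw [← zsmul_one, AddChar.map_zsmul_eq_zpow, h_one]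

theorem exists_sum_zpow_of_periodic {r : ℕ} [NeZero r] {ξ : K} (hξ : IsPrimitiveRoot ξ r)
    {φ : ℤ → K} (hφ : Function.Periodic φ r) :
    ∃ c : ZMod r → K, ∀ a, φ a = ∑ n, c n * ξ ^ ((n.val : ℤ) * a) := by
  let ψ := AddChar.zmodChar r hξ.pow_eq_one
  have hψ : ψ.IsPrimitive := AddChar.zmodChar_primitive_of_primitive_root r hξ
  have hψ_mul (n : ZMod r) (a : ℤ) : ξ ^ ((n.val : ℤ) * a) = ψ (n * a) := by
    rw [← zmodChar_intCast hξ.pow_eq_one]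
    simp [ψ]
  have hr : (r : K) ≠ 0 := NeZero.ne _
  refine ⟨fun n => (r : K)⁻¹ * ∑ d : ZMod r, φ d.val * ψ (-(n * d)), fun a => ?_⟩
  have h_val : φ (a : ZMod r).val = φ a := by
    rw [ZMod.val_intCast, ← hφ.int_mul (a / r)]
    exact congrArg φ (Int.emod_add_ediv_mul a r)
  calc φ a = (r : K)⁻¹ * ∑ d : ZMod r, φ d.val * (if (a : ZMod r) - d = 0 then (r : K) else 0) := by
        simp only [sub_eq_zero, mul_ite, mul_zero, sum_ite_eq, mem_univ, if_true, h_val]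
        field_simp
    _ = (r : K)⁻¹ * ∑ d : ZMod r, φ d.val * ∑ n, ψ (n * (a - d)) := by
        simp_rw [AddChar.sum_mulShift _ hψ, ZMod.card, Nat.cast_ite, Nat.cast_zero]
    _ = _ := by
        simp_rw [hψ_mul, mul_sum, sum_mul]
        rw [sum_comm]
        refine sum_congr rfl fun n _ => sum_congr rfl fun d _ => ?_
        rw [mul_sub, sub_eq_neg_add, AddChar.map_add_eq_mul]
        ring

theorem qPochAt_dvd_foldedSum_of_periodic {ξ : K} (hξ : 0 < orderOf ξ) (k : ℕ) {φ : ℤ → K}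
    (hφ : Function.Periodic φ (orderOf ξ)) (z : K) :
    qPochAt (localVar ξ) (2 * k + 1) ∣ foldedSum (localVar ξ) k fun x =>
      PowerSeries.C (φ x) * pexp (z * (x : K) ^ 2) := by
  have : NeZero (orderOf ξ) := ⟨hξ.ne'⟩
  obtain ⟨c, hc⟩ := exists_sum_zpow_of_periodic (.orderOf ξ) hφ
  simp_rw [hc, map_sum, sum_mul, map_mul, mul_assoc]
  rw [foldedSum_sum_mul]
  refine dvd_sum fun n _ => Dvd.dvd.mul_left ?_ _
  simpa using qPochAt_dvd_foldedSum_zpow_mul_pexp hξ k n.val z 0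

end Divisibility

/-! ### Local divisibility implies divisibility -/

section LocalDivisibility

variable {K : Type*} [Field K]

theorem associated_X_of_coeff_one_ne_zero {f : K⟦X⟧} (h_zero : PowerSeries.constantCoeff f = 0)
    (h_one : PowerSeries.coeff 1 f ≠ 0) : Associated f PowerSeries.X := by
  obtain ⟨v, rfl⟩ := PowerSeries.X_dvd_iff.2 h_zero
  rw [show (1 : ℕ) = 0 + 1 from rfl, PowerSeries.coeff_succ_X_mul,
    PowerSeries.coeff_zero_eq_constantCoeff_apply] at h_one
  exact associated_mul_unit_left _ _ (PowerSeries.isUnit_iff_constantCoeff.2 h_one.isUnit)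

theorem orderOf_le_of_qPochAt_eq_zero {ξ : K} {n : ℕ} (h : qPochAt ξ n = 0) :
    0 < orderOf ξ ∧ orderOf ξ ≤ n := by
  obtain ⟨j, hj, hj_zero⟩ := prod_eq_zero_iff.1 h
  have h_root : ξ ^ (j + 1) = 1 := (sub_eq_zero.1 hj_zero).symm
  exact ⟨orderOf_pos_iff.2 (isOfFinOrder_iff_pow_eq_one.2 ⟨j + 1, j.succ_pos, h_root⟩),
    (orderOf_le_of_pow_eq_one j.succ_pos h_root).trans (mem_range.1 hj)⟩

theorem qPochAt_ne_zero_of_lt {ξ : K} {r n : ℕ} (hξ : IsPrimitiveRoot ξ r) (hn : n < r) :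
    qPochAt ξ n ≠ 0 := fun h =>
  hn.not_ge (hξ.eq_orderOf ▸ (orderOf_le_of_qPochAt_eq_zero h).2)

variable [CharZero K]

theorem one_sub_localVar_pow_dvd_X (ξ : K) {n : ℕ} (hn : n ≠ 0) :
    (1 - localVar ξ ^ n) ∣ PowerSeries.X := by
  by_cases h : ξ ^ n = 1
  · refine (associated_X_of_coeff_one_ne_zero ?_ ?_).dvd
    · simp [h]
    · simpa [localVar_pow, h, PowerSeries.coeff_one] using hn
  · refine (PowerSeries.isUnit_iff_constantCoeff.2 ?_).dvd
    simpa using sub_ne_zero.2 (Ne.symm h)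

theorem qPochAt_localVar_dvd_X_pow (ξ : K) (n : ℕ) :
    qPochAt (localVar ξ) n ∣ PowerSeries.X ^ n := by
  simpa [qPochAt] using prod_dvd_prod_of_dvd (s := range n) (fun j => 1 - localVar ξ ^ (j + 1))
    (fun _ => PowerSeries.X) fun j _ => one_sub_localVar_pow_dvd_X ξ j.succ_ne_zero

variable {R : Type*} [CommRing R] [Algebra R K]

theorem constantCoeff_aeval_localVar (ξ : K) (P : R[X]) :
    PowerSeries.constantCoeff (aeval (localVar ξ) P) = aeval ξ P := by
  rw [aeval_def, hom_eval₂, constantCoeff_localVar]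
  rfl

theorem aeval_localVar_associated {ξ : K} (hξ : ξ ≠ 0) {P : K[X]} (hP : P ≠ 0) :
    Associated (aeval (localVar ξ) P) (PowerSeries.X ^ P.rootMultiplicity ξ) := by
  obtain ⟨Q, hQ, hQ_root⟩ := exists_eq_pow_rootMultiplicity_mul_and_not_dvd P hP ξ
  have h_unit : IsUnit (aeval (localVar ξ) Q) := by
    rw [PowerSeries.isUnit_iff_constantCoeff, constantCoeff_aeval_localVar]
    rw [dvd_iff_isRoot] at hQ_root
    simpa [IsRoot] using hQ_root
  have h_linear : Associated (aeval (localVar ξ) (X - C ξ)) PowerSeries.X := by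
    refine associated_X_of_coeff_one_ne_zero ?_ ?_
    · simp
    · simpa [localVar, PowerSeries.algebraMap_apply] using hξ
  have h := congrArg (aeval (localVar ξ)) hQ
  rw [map_mul, map_pow] at h
  exact h ▸ (associated_mul_unit_left _ _ h_unit).trans h_linear.pow_pow

/-- Over an algebraically closed field divisibility by a monic polynomial is a comparison of
root multiplicities, which are orders of vanishing in `h` at `q = ξ e^h`. -/
theorem dvd_of_aeval_localVar_dvd [IsAlgClosed K] (hR : Function.Injective (algebraMap R K))
    {f P : R[X]} (hf : f.Monic)
    (h : ∀ ξ : K, aeval ξ f = 0 → ξ ≠ 0 ∧ aeval (localVar ξ) f ∣ aeval (localVar ξ) P) :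
    f ∣ P := by
  classical
  rw [← Polynomial.map_dvd_map _ hR hf]
  rcases eq_or_ne (P.map (algebraMap R K)) 0 with hP | hP
  · exact hP ▸ dvd_zero _
  have hf' := hf.map (algebraMap R K)
  rw [(IsAlgClosed.splits _).eq_prod_roots_of_monic hf',
    Multiset.prod_X_sub_C_dvd_iff_le_roots hP, Multiset.le_iff_count]
  intro ξ
  rw [count_roots, count_roots]
  by_cases h_root : (f.map (algebraMap R K)).IsRoot ξ
  · obtain ⟨hξ, h_dvd⟩ := h ξ (by rwa [IsRoot, eval_map_algebraMap] at h_root)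
    rw [← aeval_map_algebraMap K _ f, ← aeval_map_algebraMap K _ P,
      (aeval_localVar_associated hξ hf'.ne_zero).dvd_iff_dvd_left,
      (aeval_localVar_associated hξ hP).dvd_iff_dvd_right] at h_dvd
    exact (pow_dvd_pow_iff PowerSeries.X_ne_zero PowerSeries.X_irreducible.not_isUnit).1 h_dvd
  · rw [rootMultiplicity_eq_zero h_root]
    exact Nat.zero_le _

theorem exists_monic_associated_qPoch (R : Type*) [CommRing R] (n : ℕ) :
    ∃ f : R[X], f.Monic ∧ Associated (qPoch R n) f := by
  refine ⟨∏ j ∈ range n, (X ^ (j + 1) - 1), monic_prod_of_monic _ _ fun j _ => ?_,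
    Associated.prod _ _ _ fun j _ => ?_⟩
  · simpa using monic_X_pow_sub_C (1 : R) j.succ_ne_zero
  · rw [← neg_sub]
    exact (Associated.refl _).neg_left

theorem aeval_localVar_qPoch (ξ : K) (n : ℕ) :
    aeval (localVar ξ) (qPoch R n) = qPochAt (localVar ξ) n := by
  simp [qPoch, qPochAt]

theorem qPoch_dvd_of_qPochAt_localVar_dvd [IsAlgClosed K]
    (hR : Function.Injective (algebraMap R K)) {n : ℕ} {P : R[X]}
    (h : ∀ ξ : K, 0 < orderOf ξ → orderOf ξ ≤ n →
      qPochAt (localVar ξ) n ∣ aeval (localVar ξ) P) : qPoch R n ∣ P := by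
  obtain ⟨f, hf, hf_assoc⟩ := exists_monic_associated_qPoch R n
  rw [hf_assoc.dvd_iff_dvd_left]
  refine dvd_of_aeval_localVar_dvd hR hf fun ξ hξ => ?_
  have h_local := hf_assoc.map (aeval (localVar ξ) : R[X] →ₐ[R] K⟦X⟧)
  have h_root : qPochAt ξ n = 0 := by
    have h_assoc := hf_assoc.map (aeval ξ : R[X] →ₐ[R] K)
    rw [hξ, associated_zero_iff_eq_zero] at h_assoc
    simpa [qPoch, qPochAt] using h_assoc
  obtain ⟨h_pos, h_le⟩ := orderOf_le_of_qPochAt_eq_zero h_root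
  rw [aeval_localVar_qPoch] at h_local
  exact ⟨ne_zero_of_orderOf_pos h_pos, h_local.symm.dvd.trans (h ξ h_pos h_le)⟩

end LocalDivisibility

/-! ### Families of expansions approximated by polynomials -/

/-- The family of power series `G ξ`, for roots of unity `ξ` of order in `S`, is approximated by
the expansions at `q = ξ e^h` of polynomials with coefficients in `R`, at the roots of unity of
bounded order and to finite precision in `h` at a time. -/
def Realizable {K : Type*} [Field K] [CharZero K] (R : Type*) [CommRing R] [Algebra R K]
    (S : Set ℕ) (G : K → K⟦X⟧) : Prop :=
  ∀ M N : ℕ, ∃ P : R[X], ∀ ξ : K, 0 < orderOf ξ → orderOf ξ ≤ N → orderOf ξ ∈ S →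
    PowerSeries.X ^ M ∣ aeval (localVar ξ) P - G ξ

theorem isCoprime_sub_one_geom_sum {R : Type*} [CommRing R] (y : R) {m : ℕ}
    (hm : IsUnit (m : R)) : IsCoprime (y - 1) (∑ i ∈ range m, y ^ i) := by
  obtain ⟨z, hz⟩ : y - 1 ∣ ∑ i ∈ range m, y ^ i - m := by
    rw [show ∑ i ∈ range m, y ^ i - m = ∑ i ∈ range m, (y ^ i - 1) by simp]
    exact dvd_sum fun i _ => sub_one_dvd_pow_sub_one _ _
  obtain ⟨v, hv⟩ := hm.exists_left_inv
  exact ⟨-(v * z), v, by linear_combination v * hz + hv⟩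

theorem gcd_mul_left_eq_gcd_mul_gcd_div (m : ℕ) {n : ℕ} (hn : n ≠ 0) (r : ℕ) :
    (m * n).gcd r = n.gcd r * m.gcd (r / n.gcd r) := by
  have h_pos : 0 < n.gcd r := Nat.gcd_pos_of_pos_left r (Nat.pos_of_ne_zero hn)
  obtain ⟨n', r', h_coprime, hn', hr'⟩ := Nat.exists_coprime n r
  have h_div : r / n.gcd r = r' := Nat.div_eq_of_eq_mul_left h_pos hr'
  calc (m * n).gcd r = (m * n' * n.gcd r).gcd (r' * n.gcd r) := by rw [mul_assoc, ← hn', ← hr']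
    _ = n.gcd r * m.gcd (r / n.gcd r) := by
      rw [Nat.gcd_mul_right, h_coprime.gcd_mul_right_cancel, h_div, mul_comm]

namespace Realizable

variable {K : Type*} [Field K] [CharZero K] {R : Type*} [CommRing R] [Algebra R K]
  {S T : Set ℕ} {G H : K → K⟦X⟧}

theorem congr (hG : Realizable R S G)
    (h : ∀ ξ, 0 < orderOf ξ → orderOf ξ ∈ S → G ξ = H ξ) : Realizable R S H := by
  intro M N
  obtain ⟨P, hP⟩ := hG M N
  exact ⟨P, fun ξ h_pos h_le hS => h ξ h_pos hS ▸ hP ξ h_pos h_le hS⟩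

theorem mono (hG : Realizable R T G) (h : S ⊆ T) : Realizable R S G := by
  intro M N
  obtain ⟨P, hP⟩ := hG M N
  exact ⟨P, fun ξ h_pos h_le hS => hP ξ h_pos h_le (h hS)⟩

theorem of_aeval (R : Type*) [CommRing R] [Algebra R K] (S : Set ℕ) (P : R[X]) :
    Realizable R S fun ξ : K => aeval (localVar ξ) P :=
  fun _ _ => ⟨P, fun _ _ _ _ => by simp⟩

theorem add (hG : Realizable R S G) (hH : Realizable R S H) :
    Realizable R S fun ξ => G ξ + H ξ := by
  intro M N
  obtain ⟨P, hP⟩ := hG M N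
  obtain ⟨Q, hQ⟩ := hH M N
  refine ⟨P + Q, fun ξ h_pos h_le hS => ?_⟩
  rw [map_add, add_sub_add_comm]
  exact dvd_add (hP ξ h_pos h_le hS) (hQ ξ h_pos h_le hS)

theorem mul (hG : Realizable R S G) (hH : Realizable R S H) :
    Realizable R S fun ξ => G ξ * H ξ := by
  intro M N
  obtain ⟨P, hP⟩ := hG M N
  obtain ⟨Q, hQ⟩ := hH M N
  refine ⟨P * Q, fun ξ h_pos h_le hS => ?_⟩
  rw [map_mul, ← Ideal.mem_span_singleton]
  exact Ideal.mul_sub_mul_mem _ (Ideal.mem_span_singleton.2 (hP ξ h_pos h_le hS))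
    (Ideal.mem_span_singleton.2 (hQ ξ h_pos h_le hS))

theorem sub (hG : Realizable R S G) (hH : Realizable R S H) :
    Realizable R S fun ξ => G ξ - H ξ :=
  (hG.add ((of_aeval R S (-1)).mul hH)).congr fun ξ _ _ => by simp [sub_eq_add_neg]

theorem pow (hG : Realizable R S G) (n : ℕ) : Realizable R S fun ξ => G ξ ^ n := by
  induction n with
  | zero => exact (of_aeval R S 1).congr fun ξ _ _ => by simp
  | succ n ih => exact (ih.mul hG).congr fun ξ _ _ => (pow_succ _ _).symm

theorem sum {ι : Type*} (s : Finset ι) {G : ι → K → K⟦X⟧}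
    (hG : ∀ i ∈ s, Realizable R S (G i)) : Realizable R S fun ξ => ∑ i ∈ s, G i ξ := by
  classical
  induction s using Finset.induction_on with
  | empty => exact (of_aeval R S 0).congr fun ξ _ _ => by simp
  | insert i s hi ih =>
    refine ((hG i (mem_insert_self i s)).add
      (ih fun j hj => hG j (mem_insert_of_mem hj))).congr fun ξ _ _ => ?_
    rw [sum_insert hi]

theorem foldedSum {G : ℤ → K → K⟦X⟧} (hG : ∀ a, Realizable R S (G a)) (k : ℕ) :
    Realizable R S fun ξ => LaplaceTransform.foldedSum (localVar ξ) k fun a => G a ξ := by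
  refine sum _ fun a _ => mul ?_ ((hG a).sub (hG (-1 - a)))
  exact (of_aeval R S ((-1) ^ a * X ^ ((a + 1).choose 2)
    * (∏ l ∈ Ico (k - a) k, (1 - X ^ (l + 1)))
    * ∏ l ∈ Ico (k + 1 + a) (2 * k + 1), (1 - X ^ (l + 1)))).congr fun ξ _ _ => by simp

theorem union_of_isCoprime (hS : Realizable R S G) (hT : Realizable R T G)
    (h : ∀ N : ℕ, ∃ U V : R[X], IsCoprime U V ∧ ∀ ξ : K, 0 < orderOf ξ → orderOf ξ ≤ N →
      (orderOf ξ ∈ S → aeval ξ U = 0) ∧ (orderOf ξ ∈ T → aeval ξ V = 0)) :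
    Realizable R (S ∪ T) G := by
  intro M N
  obtain ⟨P, hP⟩ := hS M N
  obtain ⟨Q, hQ⟩ := hT M N
  obtain ⟨U, V, hUV, h_root⟩ := h N
  obtain ⟨A, B, hAB⟩ := hUV.pow (m := M) (n := M)
  have h_vanish {ξ : K} {W : R[X]} (hW : aeval ξ W = 0) (Z : R[X]) :
      PowerSeries.X ^ M ∣ aeval (localVar ξ) (Z * W ^ M) := by
    rw [map_mul, map_pow]
    refine (pow_dvd_pow_of_dvd ?_ M).mul_left _
    rwa [PowerSeries.X_dvd_iff, constantCoeff_aeval_localVar]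
  refine ⟨P + A * U ^ M * (Q - P), fun ξ h_pos h_le h_mem => ?_⟩
  rcases h_mem with h_mem | h_mem
  · rw [map_add, map_mul, add_sub_right_comm]
    exact dvd_add (hP ξ h_pos h_le h_mem)
      ((h_vanish ((h_root ξ h_pos h_le).1 h_mem) A).mul_right _)
  · rw [show P + A * U ^ M * (Q - P) = Q - B * V ^ M * (Q - P) by
      rw [eq_sub_of_add_eq hAB]; ring, map_sub, map_mul, sub_right_comm]
    exact dvd_sub (hQ ξ h_pos h_le h_mem)
      ((h_vanish ((h_root ξ h_pos h_le).2 h_mem) B).mul_right _)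

theorem of_prime_split {p c : ℕ} (hp : p.Prime) (hpR : IsUnit (p : R)) (hc : c ≠ 0)
    (hS : ∀ r ∈ S, c ∣ r) (h₁ : Realizable R {r ∈ S | ¬ c * p ∣ r} G)
    (h₂ : Realizable R {r ∈ S | c * p ∣ r} G) : Realizable R S G := by
  refine (h₁.union_of_isCoprime h₂ fun N => ?_).mono fun r hr => by
    by_cases h : c * p ∣ r
    exacts [Or.inr ⟨hr, h⟩, Or.inl ⟨hr, h⟩]
  obtain ⟨t, L, hL, hN⟩ := Nat.exists_eq_pow_mul_and_not_dvd (Nat.factorial_ne_zero N) p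
    hp.ne_one
  refine ⟨X ^ (c * L) - 1, ∑ i ∈ range (p ^ t), (X ^ (c * L)) ^ i,
    isCoprime_sub_one_geom_sum _ ?_, fun ξ h_pos h_le => ⟨?_, ?_⟩⟩
  · simpa using (hpR.pow t).map (C : R →+* R[X])
  · rintro ⟨hξS, h_ndvd⟩
    obtain ⟨s, hs⟩ := hS _ hξS
    have hps : ¬ p ∣ s := fun h => h_ndvd (hs ▸ mul_dvd_mul_left c h)
    have hsL : s ∣ L := ((hp.coprime_iff_not_dvd.2 hps).symm.pow_right t).dvd_of_dvd_mul_left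
      (hN ▸ (Dvd.intro_left c hs.symm).trans (Nat.dvd_factorial h_pos h_le))
    simp [orderOf_dvd_iff_pow_eq_one.1 (hs ▸ mul_dvd_mul_left c hsL)]
  · rintro ⟨-, h_dvd⟩
    have h_ne : ξ ^ (c * L) - 1 ≠ 0 := fun h => hL <| Nat.dvd_of_mul_dvd_mul_left
      (Nat.pos_of_ne_zero hc) (h_dvd.trans (orderOf_dvd_of_pow_eq_one (sub_eq_zero.1 h)))
    have h_one : (ξ ^ (c * L)) ^ p ^ t = 1 := by
      rw [← pow_mul, mul_assoc, mul_comm L, ← hN]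
      exact orderOf_dvd_iff_pow_eq_one.1 ((Nat.dvd_factorial h_pos h_le).mul_left c)
    have h_geom := mul_geom_sum (ξ ^ (c * L)) (p ^ t)
    rw [h_one, sub_self] at h_geom
    simpa using (mul_eq_zero.1 h_geom).resolve_left h_ne

theorem of_gcd_eq {n : ℕ} (hn : IsUnit (n : R))
    (h : ∀ c, c ∣ n → Realizable R {r ∈ S | n.gcd r = c} G) : Realizable R S G := by
  induction n using induction_on_primes generalizing S with
  | zero =>
    have := (algebraMap R K).domain_nontrivial
    simp at hn
  | one => exact (h 1 dvd_rfl).mono fun r hr => ⟨hr, Nat.gcd_one_left r⟩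
  | prime_mul p n hp ih =>
    rw [Nat.cast_mul, IsUnit.mul_iff] at hn
    have hn_zero : n ≠ 0 := by
      rintro rfl
      have := (algebraMap R K).domain_nontrivial
      simp at hn
    refine ih hn.2 fun c hc => ?_
    refine of_prime_split hp hn.1 (ne_zero_of_dvd_ne_zero hn_zero hc)
      (fun r hr => hr.2 ▸ Nat.gcd_dvd_right n r) ?_ ?_
    · refine (h c (hc.mul_left p)).mono ?_
      rintro r ⟨⟨hrS, hr⟩, h_ndvd⟩
      rw [← Nat.dvd_div_iff_mul_dvd (hr ▸ Nat.gcd_dvd_right n r),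
        ← hp.coprime_iff_not_dvd] at h_ndvd
      exact ⟨hrS, by rw [gcd_mul_left_eq_gcd_mul_gcd_div p hn_zero, hr, h_ndvd, mul_one]⟩
    · refine (h (c * p) (mul_comm p c ▸ mul_dvd_mul_left p hc)).mono ?_
      rintro r ⟨⟨hrS, hr⟩, h_dvd⟩
      rw [← Nat.dvd_div_iff_mul_dvd (hr ▸ Nat.gcd_dvd_right n r)] at h_dvd
      exact ⟨hrS, by rw [gcd_mul_left_eq_gcd_mul_gcd_div p hn_zero, hr,
        Nat.gcd_eq_left h_dvd]⟩

theorem of_qPoch_mul [IsAlgClosed K] (hR : Function.Injective (algebraMap R K)) {n : ℕ}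
    (h : Realizable R Set.univ fun ξ => qPochAt (localVar ξ) n * G ξ) :
    Realizable R Set.univ G := by
  intro M N
  obtain ⟨P, hP⟩ := h (n + M) (max N n)
  obtain ⟨Q, rfl⟩ : qPoch R n ∣ P := by
    refine qPoch_dvd_of_qPochAt_localVar_dvd hR fun ξ h_pos h_le => ?_
    have h_approx := (qPochAt_localVar_dvd_X_pow ξ n).trans <|
      (pow_dvd_pow _ (n.le_add_right M)).trans <|
        hP ξ h_pos (h_le.trans (le_max_right _ _)) trivial
    exact (dvd_sub_left (dvd_mul_right _ _)).1 h_approx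
  refine ⟨Q, fun ξ h_pos h_le _ => ?_⟩
  have h_approx := hP ξ h_pos (h_le.trans (le_max_left _ _)) trivial
  rw [map_mul, aeval_localVar_qPoch, ← mul_sub, pow_add] at h_approx
  exact (mul_dvd_mul_iff_left (pow_ne_zero n PowerSeries.X_ne_zero)).1
    (h_approx.trans (mul_dvd_mul_right (qPochAt_localVar_dvd_X_pow ξ n) _))

end Realizable

section Root

theorem exists_approx_root {R : Type*} [CommRing R] {n : ℕ} (hn : IsUnit (n : R)) (s M : ℕ) :
    ∃ g : R[X], g.eval 1 = 1 ∧ (X - 1) ^ (M + 1) ∣ g ^ n * X ^ s - 1 := by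
  induction M with
  | zero => exact ⟨1, by simp, by simpa using sub_one_dvd_pow_sub_one (X : R[X]) s⟩
  | succ M ih =>
    obtain ⟨g, hg, d, hd⟩ := ih
    obtain ⟨v, hv⟩ := hn.exists_left_inv
    set t : R := -(v * d.eval 1) with ht
    obtain ⟨e, he⟩ := powAddExpansion g (C t * (X - 1) ^ (M + 1)) n
    refine ⟨g + C t * (X - 1) ^ (M + 1), by simp [hg], ?_⟩
    have h_expand : (g + C t * (X - 1) ^ (M + 1)) ^ n * X ^ s - 1
        = (X - 1) ^ (M + 1) * (d + (n : R[X]) * g ^ (n - 1) * C t * X ^ s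
          + e * C t ^ 2 * (X - 1) ^ (M + 1) * X ^ s) := by
      rw [he, mul_add, mul_add, ← hd]
      ring
    rw [h_expand, pow_succ, ← C_1]
    refine mul_dvd_mul_left _ (dvd_iff_isRoot.2 ?_)
    simp only [IsRoot, eval_add, eval_mul, eval_pow, eval_sub, eval_X, eval_C, eval_natCast, hg, ht]
    linear_combination (-(d.eval 1)) * hv

theorem exists_nat_mul_eq_mul_add {L n : ℕ} (hL : 0 < L) (hn : 0 < n) (h : L.Coprime n) (ε : ℤ) :
    ∃ s m : ℕ, (L : ℤ) * s = m * n + ε := by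
  obtain ⟨x, y, hxy⟩ := Nat.isCoprime_iff_coprime.2 h
  have hL' : (1 : ℤ) ≤ L := by exact_mod_cast hL
  have hn' : (1 : ℤ) ≤ n := by exact_mod_cast hn
  set t := |ε * x| + |ε * y| with ht
  have hx : 0 ≤ ε * x + n * t := by
    nlinarith only [hn', ht, neg_abs_le (ε * x), abs_nonneg (ε * y), abs_nonneg (ε * x)]
  have hy : 0 ≤ L * t - ε * y := by
    nlinarith only [hL', ht, le_abs_self (ε * y), abs_nonneg (ε * y), abs_nonneg (ε * x)]
  lift ε * x + n * t to ℕ using hx with s hs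
  lift L * t - ε * y to ℕ using hy with m hm
  exact ⟨s, m, by rw [hs, hm]; linear_combination ε * hxy⟩

variable {K : Type*} [Field K] [CharZero K]

theorem X_pow_dvd_sub_of_pow {f g : K⟦X⟧} {n M : ℕ} (hn : n ≠ 0)
    (hf : PowerSeries.constantCoeff f = 1) (hg : PowerSeries.constantCoeff g = 1)
    (h : PowerSeries.X ^ M ∣ f ^ n - g ^ n) : PowerSeries.X ^ M ∣ f - g := by
  rw [← Commute.geom_sum₂_mul (Commute.all f g)] at h
  refine (IsUnit.dvd_mul_left (PowerSeries.isUnit_iff_constantCoeff.2 ?_)).1 h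
  simp [hf, hg, hn]

variable {R : Type*} [CommRing R] [Algebra R K]

theorem exists_aeval_pexp_approx {n : ℕ} (hn : IsUnit (n : R)) (s M : ℕ) :
    ∃ g : R[X], ∀ x : K, PowerSeries.X ^ M ∣ aeval (pexp x) g - pexp (-(s * x / n)) := by
  have hn_zero : (n : K) ≠ 0 := by simpa using (hn.map (algebraMap R K)).ne_zero
  obtain ⟨g, hg, h_approx⟩ := exists_approx_root hn s M
  refine ⟨g, fun x => X_pow_dvd_sub_of_pow (Nat.cast_ne_zero.1 hn_zero) ?_ (by simp) ?_⟩
  · rw [aeval_def, hom_eval₂, constantCoeff_pexp]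
    simp [hg]
  · have h_inv : pexp (-(s * x / n)) ^ n * pexp x ^ s = 1 := by
      rw [pexp_pow, pexp_pow, ← pexp_add, ← pexp_zero]
      congr 1
      field_simp
      ring
    have h_aeval : PowerSeries.X ^ M ∣ aeval (pexp x) (g ^ n * X ^ s - 1) := by
      refine ((pow_dvd_pow _ M.le_succ).trans (pow_dvd_pow_of_dvd ?_ _)).trans
        (by simpa using map_dvd (aeval (pexp x)) h_approx)
      simp [PowerSeries.X_dvd_iff]
    refine (IsUnit.of_mul_eq_one_right _ h_inv).dvd_mul_right.1 ?_
    simpa [sub_mul, h_inv] using h_aeval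

theorem exists_coprime_multiple {c n N : ℕ} {S : Set ℕ}
    (hS : ∀ r ∈ S, c ∣ r ∧ (r / c).Coprime n) :
    ∃ L, 0 < L ∧ L.Coprime n ∧ ∀ r ∈ S, 0 < r → r ≤ N → r ∣ c * L := by
  classical
  refine ⟨∏ r ∈ Icc 1 N with r ∈ S, r / c, prod_pos fun r hr => ?_,
    Nat.Coprime.prod_left fun r hr => (hS r (mem_filter.1 hr).2).2, fun r hr h_pos h_le => ?_⟩
  · rw [mem_filter, mem_Icc] at hr
    have h_dvd := (hS r hr.2).1
    exact Nat.div_pos (Nat.le_of_dvd hr.1.1 h_dvd) (Nat.pos_of_dvd_of_pos h_dvd hr.1.1)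
  · calc r = c * (r / c) := (Nat.mul_div_cancel' (hS r hr).1).symm
      _ ∣ c * _ := mul_dvd_mul_left c (dvd_prod_of_mem (fun r => r / c)
        (mem_filter.2 ⟨mem_Icc.2 ⟨h_pos, h_le⟩, hr⟩))

/-- The family `q^{-cε/n}`; the root of unity `ω ξ` is the value of that power at `q = ξ`
prescribed by the congruence. -/
theorem realizable_fractional_pow {c n : ℕ} (hn : IsUnit (n : R)) (ε : ℤ) {S : Set ℕ}
    (hS : ∀ r ∈ S, c ∣ r ∧ (r / c).Coprime n) {ω : K → K}
    (hω : ∀ ξ : K, 0 < orderOf ξ → orderOf ξ ∈ S → ∀ m : ℕ,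
      (orderOf ξ : ℤ) ∣ c * (m * n + ε) → ω ξ = ξ ^ (c * m)) :
    Realizable R S fun ξ => PowerSeries.C (ω ξ) * pexp (-(c * ε / n) : K) := by
  intro M N
  have hn_zero : (n : K) ≠ 0 := by simpa using (hn.map (algebraMap R K)).ne_zero
  obtain ⟨L, hL, hLn, h_dvd⟩ := exists_coprime_multiple (N := N) hS
  obtain ⟨s, m, hsm⟩ :=
    exists_nat_mul_eq_mul_add hL (Nat.pos_of_ne_zero (Nat.cast_ne_zero.1 hn_zero)) hLn ε
  obtain ⟨g, hg⟩ := exists_aeval_pexp_approx (K := K) hn s M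
  refine ⟨X ^ (c * m) * g.comp (X ^ (c * L)), fun ξ h_pos h_le hξS => ?_⟩
  have h_order := h_dvd _ hξS h_pos h_le
  have h_root : ω ξ = ξ ^ (c * m) := by
    refine hω ξ h_pos hξS m ?_
    rw [← hsm, ← mul_assoc]
    exact (by exact_mod_cast h_order : (orderOf ξ : ℤ) ∣ c * L).mul_right _
  have h_local : localVar ξ ^ (c * L) = pexp (c * L : K) := by
    simp [localVar_pow, orderOf_dvd_iff_pow_eq_one.1 h_order]
  have h_exponent : -(c * ε / n : K) = c * m + -(s * (c * L) / n) := by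
    have hsm' : (L : K) * s = m * n + ε := by exact_mod_cast hsm
    field_simp
    linear_combination (c : K) * hsm'
  dsimp only
  rw [map_mul, aeval_comp, map_pow, map_pow, aeval_X, h_local, h_root, h_exponent, pexp_add,
    ← mul_assoc, localVar_pow, Nat.cast_mul, ← mul_sub]
  exact (hg _).mul_left _

theorem realizable_localPow_neg_one (R : Type*) [CommRing R] [Algebra R K] (S : Set ℕ) :
    Realizable R S fun ξ : K => localPow ξ (-1) := by
  refine (realizable_fractional_pow (c := 1) (n := 1) (ω := fun ξ => ξ⁻¹) (by simp) 1
    (by simp) fun ξ _ _ m hm => ?_).congr fun ξ _ _ => by simp [localPow]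
  have h_pow : ξ ^ (m + 1) = 1 := by
    rw [← orderOf_dvd_iff_pow_eq_one]
    exact_mod_cast (by simpa using hm : (orderOf ξ : ℤ) ∣ m + 1)
  rw [one_mul]
  exact inv_eq_of_mul_eq_one_left (by rw [← pow_succ, h_pow])

end Root

/-! ### Realizable families define elements of the completion -/

theorem algebraMap_ZInv_injective (b : ℤ) : Function.Injective (algebraMap (ZInv b) ℂ) :=
  fun _ _ h => Subtype.ext (Rat.cast_injective (α := ℂ) h)

theorem exists_compatible_approximations {K : Type*} [Field K] [CharZero K] [IsAlgClosed K]
    {R : Type*} [CommRing R] [Algebra R K] (hR : Function.Injective (algebraMap R K))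
    {G : K → K⟦X⟧} (hG : Realizable R Set.univ G) :
    ∃ P : ℕ → R[X], (∀ k m, k ≤ m → qPoch R k ∣ P m - P k) ∧
      ∀ (ξ : K) k, 0 < orderOf ξ → orderOf ξ ≤ k →
        aeval ξ (P k) = PowerSeries.constantCoeff (G ξ) := by
  choose P hP using fun k => hG k k
  refine ⟨P, fun k m hkm => qPoch_dvd_of_qPochAt_localVar_dvd hR fun ξ h_pos h_le => ?_,
    fun ξ k h_pos h_le => ?_⟩
  · have h_local {j : ℕ} (hj : k ≤ j) :
        qPochAt (localVar ξ) k ∣ aeval (localVar ξ) (P j) - G ξ :=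
      (qPochAt_localVar_dvd_X_pow ξ k).trans
        ((pow_dvd_pow _ hj).trans (hP j ξ h_pos (h_le.trans hj) trivial))
    rw [map_sub, ← sub_sub_sub_cancel_right _ _ (G ξ)]
    exact dvd_sub (h_local hkm) (h_local le_rfl)
  · have h_approx := (dvd_pow_self _ (h_pos.trans_le h_le).ne').trans (hP k ξ h_pos h_le trivial)
    rwa [PowerSeries.X_dvd_iff, map_sub, sub_eq_zero, constantCoeff_aeval_localVar] at h_approx

theorem Realizable.exists_evR_sToR_eq {b : ℤ} {G : ℂ → ℂ⟦X⟧}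
    (hG : Realizable (ZInv b) Set.univ G) :
    ∃ Q : SRing b, ∀ (ξ : ℂ) (r : ℕ) (hξ : IsPrimitiveRoot ξ r) (hr : Odd r),
      evR b hξ hr (sToR b Q) = PowerSeries.constantCoeff (G ξ) := by
  obtain ⟨P, h_compat, h_eval⟩ := exists_compatible_approximations (algebraMap_ZInv_injective b) hG
  have h_mem : (fun k => Ideal.Quotient.mk (Ideal.span {qPoch (ZInv b) k}) (P k)) ∈ SRing b := by
    intro k m hkm
    rw [Ideal.Quotient.factor_mk, Ideal.Quotient.mk_eq_mk_iff_sub_mem, Ideal.mem_span_singleton]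
    exact h_compat k m hkm
  refine ⟨⟨_, h_mem⟩, fun ξ r hξ hr => ?_⟩
  have h_order := hξ.eq_orderOf
  exact h_eval ξ (2 * r) (h_order ▸ hr.pos) (by lia)

/-! ### Evaluation of rational functions -/

section Evaluation

universe u

variable {K L : Type u} [Field K] [Field L] [Algebra K L]

/-- The rational function `f` is regular at `ξ`, with value `v`. -/
def HasEv (ξ : L) (f : RatFunc K) (v : L) : Prop :=
  f.denom.eval₂ (algebraMap K L) ξ ≠ 0 ∧ f.eval (algebraMap K L) ξ = v

variable {ξ : L} {f g : RatFunc K} {v w : L}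

theorem hasEv_algebraMap (ξ : L) (P : K[X]) :
    HasEv ξ (algebraMap K[X] (RatFunc K) P) (aeval ξ P) := by
  simp [HasEv, RatFunc.eval, aeval_def]

theorem hasEv_one (ξ : L) : HasEv ξ (1 : RatFunc K) 1 := by
  simpa using hasEv_algebraMap ξ (1 : K[X])

theorem hasEv_X (ξ : L) : HasEv ξ (RatFunc.X : RatFunc K) ξ := by
  simpa using hasEv_algebraMap ξ (X : K[X])

theorem HasEv.mul (hf : HasEv ξ f v) (hg : HasEv ξ g w) : HasEv ξ (f * g) (v * w) :=
  ⟨fun h => mul_ne_zero hf.1 hg.1 <| by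
      rw [← eval₂_mul]
      exact eval₂_eq_zero_of_dvd_of_eval₂_eq_zero _ _ (RatFunc.denom_mul_dvd f g) h,
    by rw [RatFunc.eval_mul _ _ hf.1 hg.1, hf.2, hg.2]⟩

theorem HasEv.add (hf : HasEv ξ f v) (hg : HasEv ξ g w) : HasEv ξ (f + g) (v + w) :=
  ⟨fun h => mul_ne_zero hf.1 hg.1 <| by
      rw [← eval₂_mul]
      exact eval₂_eq_zero_of_dvd_of_eval₂_eq_zero _ _ (RatFunc.denom_add_dvd f g) h,
    by rw [RatFunc.eval_add _ _ hf.1 hg.1, hf.2, hg.2]⟩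

theorem HasEv.sub (hf : HasEv ξ f v) (hg : HasEv ξ g w) : HasEv ξ (f - g) (v - w) := by
  simpa [sub_eq_add_neg] using hf.add ((hasEv_algebraMap ξ (-1 : K[X])).mul hg)

theorem HasEv.inv (hf : HasEv ξ f v) (hv : v ≠ 0) : HasEv ξ f⁻¹ v⁻¹ := by
  have hf₀ : f ≠ 0 := by
    rintro rfl
    exact hv (by simpa using hf.2.symm)
  have h_num : f.num.eval₂ (algebraMap K L) ξ ≠ 0 := fun h =>
    hv (by rw [← hf.2, RatFunc.eval, h, zero_div])
  have h_denom : f⁻¹.denom.eval₂ (algebraMap K L) ξ ≠ 0 := fun h =>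
    h_num (eval₂_eq_zero_of_dvd_of_eval₂_eq_zero _ _ (RatFunc.denom_inv_dvd hf₀) h)
  refine ⟨h_denom, eq_inv_of_mul_eq_one_left ?_⟩
  rw [← hf.2, ← RatFunc.eval_mul _ _ h_denom hf.1, inv_mul_cancel₀ hf₀, RatFunc.eval_one]

theorem HasEv.div (hf : HasEv ξ f v) (hg : HasEv ξ g w) (hw : w ≠ 0) :
    HasEv ξ (f / g) (v / w) := by
  simpa only [div_eq_mul_inv] using hf.mul (hg.inv hw)

theorem hasEv_X_zpow (hξ : ξ ≠ 0) (x : ℤ) : HasEv ξ ((RatFunc.X : RatFunc K) ^ x) (ξ ^ x) := by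
  have h_pow (n : ℕ) : HasEv ξ ((RatFunc.X : RatFunc K) ^ n) (ξ ^ n) := by
    simpa using hasEv_algebraMap ξ (X ^ n : K[X])
  obtain ⟨n, rfl | rfl⟩ := x.eq_nat_or_neg
  · exact_mod_cast h_pow n
  · simpa using (h_pow n).inv (pow_ne_zero n hξ)

theorem HasEv.prod {ι : Type*} (s : Finset ι) {f : ι → RatFunc K} {v : ι → L}
    (h : ∀ i, HasEv ξ (f i) (v i)) : HasEv ξ (∏ i ∈ s, f i) (∏ i ∈ s, v i) := by
  induction s using Finset.cons_induction with
  | empty => simpa using hasEv_one ξ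
  | cons i s hi ih => simpa only [prod_cons] using (h i).mul ih

end Evaluation

theorem one_sub_q_ne_zero : (1 : RatFunc ℚ) - q ≠ 0 := by
  rw [sub_ne_zero, ← map_one (algebraMap ℚ[X] (RatFunc ℚ)), q, ← RatFunc.algebraMap_X,
    (RatFunc.algebraMap_injective ℚ).ne_iff]
  exact X_ne_C 1 |>.symm

section Colored

variable {ξ : ℂ}

theorem hasEv_framing (hξ : ξ ≠ 0) (b : ℤ) (n : ℕ) :
    HasEv ξ (framing b n) (ξ ^ (b * (((n : ℤ) ^ 2 - 1) / 4))) :=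
  hasEv_X_zpow hξ _

theorem hasEv_quantumInt (hξ : ξ ≠ 0) (n : ℕ) : HasEv ξ (quantumInt n)
    (ξ ^ (-(((n : ℤ) - 1) / 2)) * ∑ i ∈ range n, ξ ^ i) := by
  have h_geom : (1 - q ^ n) / (1 - q)
      = algebraMap ℚ[X] (RatFunc ℚ) (∑ i ∈ range n, X ^ i) := by
    rw [div_eq_iff one_sub_q_ne_zero, ← geom_sum_mul_neg]
    simp [q]
  rw [quantumInt, h_geom]
  convert (hasEv_X_zpow hξ _).mul (hasEv_algebraMap ξ (∑ i ∈ range n, X ^ i : ℚ[X])) using 2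
  simp

theorem hasEv_A (hξ : ξ ≠ 0) (n k : ℕ)
    (hd : (1 - ξ) * ∏ j ∈ range (k + 1), (1 - ξ ^ (k + 1) * ξ ^ j) ≠ 0) :
    HasEv ξ (A n k) ((∏ i ∈ range (k + 1),
      (ξ ^ (n : ℤ) + ξ ^ (-(n : ℤ)) - ξ ^ (i : ℤ) - ξ ^ (-(i : ℤ)))) /
      ((1 - ξ) * ∏ j ∈ range (k + 1), (1 - ξ ^ (k + 1) * ξ ^ j))) := by
  have h_pow (m : ℕ) : HasEv ξ (q ^ m) (ξ ^ m) := mod_cast hasEv_X_zpow (K := ℚ) hξ m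
  exact ((HasEv.prod _ fun i => (((hasEv_X_zpow hξ _).add (hasEv_X_zpow hξ _)).sub
    (hasEv_X_zpow hξ _)).sub (hasEv_X_zpow hξ _))).div
      (((hasEv_one ξ).sub (hasEv_X ξ)).mul
        (HasEv.prod _ fun j => (hasEv_one ξ).sub ((h_pow _).mul (h_pow j)))) hd

theorem A_zero_eq {n : ℕ} (hn : Odd n) : A n 0 = q ^ (-1 : ℤ) * (quantumInt n * quantumInt n) := by
  obtain ⟨m, rfl⟩ := hn
  have hq : (q : RatFunc ℚ) ≠ 0 := RatFunc.X_ne_zero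
  have h_half : (((2 * m + 1 : ℕ) : ℤ) - 1) / 2 = m := by omega
  rw [A, quantumInt, h_half]
  simp only [zero_add, range_one, prod_singleton, pow_zero, mul_one, pow_one, zpow_neg,
    zpow_natCast, zpow_one]
  field_simp [one_sub_q_ne_zero]
  ring

end Colored

/-! ### Quadratic Gauss sums -/

section GaussSum

variable {K : Type*} [Field K] {r : ℕ} [NeZero r]

/-- The quadratic exponential sum `∑_x χ(β x² + 4 a x)` over `ℤ/r`. -/
def quadSum (χ : AddChar (ZMod r) K) (β a : ZMod r) : K := ∑ x, χ (β * x ^ 2 + 4 * a * x)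

theorem quadSum_of_mul_eq (χ : AddChar (ZMod r) K) {β a d : ZMod r} (h : β * d = a) :
    quadSum χ β a = χ (-(4 * a * d)) * quadSum χ β 0 := by
  rw [quadSum, quadSum, mul_sum, ← Equiv.sum_comp (Equiv.addRight (-(2 * d)))]
  refine sum_congr rfl fun x _ => ?_
  rw [← AddChar.map_add_eq_mul, Equiv.coe_addRight, ← h]
  congr 1
  ring

theorem quadSum_eq_zero (χ : AddChar (ZMod r) K) {β a t : ZMod r} (h : β * t = 0)
    (ht : χ (4 * a * t) ≠ 1) : quadSum χ β a = 0 := by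
  have h_shift : quadSum χ β a = χ (4 * a * t) * quadSum χ β a := by
    rw [quadSum, mul_sum, ← Equiv.sum_comp (Equiv.addRight t)]
    refine sum_congr rfl fun x _ => ?_
    rw [← AddChar.map_add_eq_mul, Equiv.coe_addRight]
    congr 1
    linear_combination (2 * x + t) * h
  by_contra h_ne
  exact ht ((right_eq_mul₀ h_ne).1 h_shift)

theorem quadSum_zero_mul_sum_neg {χ : AddChar (ZMod r) K} (hχ : χ.IsPrimitive)
    (h_two : IsUnit (2 : ZMod r)) (β : ZMod r) :
    quadSum χ β 0 * ∑ y, χ (-(β * y ^ 2)) = r * #{d : ZMod r | β * d = 0} := by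
  have h_shift (y : ZMod r) : (∑ x, χ (β * x ^ 2 + 4 * 0 * x)) * χ (-(β * y ^ 2))
      = ∑ d, χ (β * d ^ 2) * χ (y * (2 * β * d)) := by
    rw [sum_mul, ← Equiv.sum_comp (Equiv.addRight y)]
    refine sum_congr rfl fun d _ => ?_
    rw [← AddChar.map_add_eq_mul, ← AddChar.map_add_eq_mul, Equiv.coe_addRight]
    congr 1
    ring
  have h_orth (d : ZMod r) : ∑ y, χ (β * d ^ 2) * χ (y * (2 * β * d))
      = if β * d = 0 then (r : K) else 0 := by
    simp only [← mul_sum, AddChar.sum_mulShift _ hχ, ZMod.card, mul_assoc, h_two.mul_right_eq_zero]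
    split_ifs with h
    · rw [sq, ← mul_assoc, h, zero_mul, AddChar.map_zero_eq_one, one_mul]
    · simp
  simp_rw [quadSum, mul_sum, h_shift]
  rw [sum_comm]
  simp_rw [h_orth]
  rw [← sum_filter, sum_const, nsmul_eq_mul, mul_comm]

theorem quadSum_zero_ne_zero [CharZero K] {χ : AddChar (ZMod r) K} (hχ : χ.IsPrimitive)
    (h_two : IsUnit (2 : ZMod r)) (β : ZMod r) : quadSum χ β 0 ≠ 0 := by
  have h_card : (#{d : ZMod r | β * d = 0} : K) ≠ 0 :=
    Nat.cast_ne_zero.2 (card_pos.2 ⟨0, by simp⟩).ne'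
  refine left_ne_zero_of_mul (b := ∑ y, χ (-(β * y ^ 2))) ?_
  rw [quadSum_zero_mul_sum_neg hχ h_two]
  exact mul_ne_zero (NeZero.ne _) h_card

theorem sum_odd_eq_sum_zmod (hr : Odd r) (f : ZMod r → K) :
    ∑ n ∈ (Ioo 0 (2 * r)).filter Odd, f n = ∑ x, f x := by
  refine sum_nbij' (fun n : ℕ => (n : ZMod r))
    (fun x => if Odd x.val then x.val else x.val + r) (fun n _ => mem_univ _) (fun x _ => ?_)
    (fun n hn => ?_) (fun x _ => ?_) (fun n _ => rfl)
  · have h_lt := ZMod.val_lt x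
    rw [mem_filter, mem_Ioo]
    split_ifs with h
    · exact ⟨⟨h.pos, by lia⟩, h⟩
    · exact ⟨⟨by have := hr.pos; lia, by lia⟩, (Nat.not_odd_iff_even.1 h).add_odd hr⟩
  · obtain ⟨⟨h_pos, h_lt⟩, h_odd⟩ := by simpa only [mem_filter, mem_Ioo] using hn
    rw [ZMod.val_natCast]
    rcases lt_or_ge n r with h | h
    · rw [Nat.mod_eq_of_lt h, if_pos h_odd]
    · rw [Nat.mod_eq_sub_mod h, Nat.mod_eq_of_lt (by lia),
        if_neg (Nat.not_odd_iff_even.2 (Nat.Odd.sub_odd h_odd hr)), Nat.sub_add_cancel h]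
  · split_ifs <;> simp

end GaussSum

/-! ### The Laplace transform of a monomial at a root of unity -/

section LaplaceValue

variable {K : Type*} [Field K] {b : ℤ} {ξ : K}

open Classical in
/-- The value at `ξ`, of order `r`, of the Laplace transform of `x^a`: it is the value `ξ^{-ad}`
of `q^{-a²/b}`, where `bd ≡ a` modulo `r`, and `0` if this congruence has no solution. -/
def laplaceValue (b : ℤ) (ξ : K) (a : ℤ) : K :=
  if h : ∃ d : ℤ, (orderOf ξ : ℤ) ∣ b * d - a then ξ ^ (-(a * h.choose)) else 0

theorem exists_dvd_mul_sub_iff {b r a : ℤ} : (∃ d, r ∣ b * d - a) ↔ (b.gcd r : ℤ) ∣ a := by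
  refine ⟨fun ⟨d, hd⟩ => ?_, fun ⟨x, hx⟩ => ⟨b.gcdA r * x, -(b.gcdB r * x), ?_⟩⟩
  · have h_bd : (b.gcd r : ℤ) ∣ b * d := (Int.gcd_dvd_left ..).mul_right d
    simpa using h_bd.sub ((Int.gcd_dvd_right ..).trans hd)
  · rw [hx, Int.gcd_eq_gcd_ab]
    ring

theorem laplaceValue_eq_zpow (hξ : 0 < orderOf ξ) {a d : ℤ}
    (h : (orderOf ξ : ℤ) ∣ b * d - a) : laplaceValue b ξ a = ξ ^ (-(a * d)) := by
  have h_ex : ∃ d : ℤ, (orderOf ξ : ℤ) ∣ b * d - a := ⟨d, h⟩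
  have hξ₀ : ξ ≠ 0 := ne_zero_of_orderOf_pos hξ
  rw [laplaceValue, dif_pos h_ex, ← div_eq_one_iff_eq (zpow_ne_zero _ hξ₀), ← zpow_sub₀ hξ₀,
    (IsPrimitiveRoot.orderOf ξ).zpow_eq_one_iff_dvd]
  generalize_proofs h_choose
  have h_eq : -(a * h_ex.choose) - -(a * d)
      = h_ex.choose * (b * d - a) - d * (b * h_ex.choose - a) := by ring
  rw [h_eq]
  exact (h.mul_left _).sub (h_ex.choose_spec.mul_left _)

theorem laplaceValue_eq_zero {a : ℤ} (h : ¬ (b.gcd (orderOf ξ) : ℤ) ∣ a) :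
    laplaceValue b ξ a = 0 :=
  dif_neg (exists_dvd_mul_sub_iff.not.2 h)

theorem laplaceValue_mul (hξ : 0 < orderOf ξ) {a : ℤ} (h : (b.gcd (orderOf ξ) : ℤ) ∣ a) (x : ℤ) :
    laplaceValue b ξ (a * x) = laplaceValue b ξ a ^ (x ^ 2) := by
  obtain ⟨d, hd⟩ := exists_dvd_mul_sub_iff.2 h
  have hdx : (orderOf ξ : ℤ) ∣ b * (d * x) - a * x := by
    simpa only [sub_mul, mul_assoc] using hd.mul_right x
  rw [laplaceValue_eq_zpow hξ hd, laplaceValue_eq_zpow hξ hdx, ← zpow_mul]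
  ring_nf

theorem laplaceValue_periodic (hξ : 0 < orderOf ξ) :
    Function.Periodic (laplaceValue b ξ) (orderOf ξ) := fun a => by
  by_cases h : (b.gcd (orderOf ξ) : ℤ) ∣ a
  · obtain ⟨d, hd⟩ := exists_dvd_mul_sub_iff.2 h
    have h_shift : (orderOf ξ : ℤ) ∣ b * d - (a + orderOf ξ) := by
      simpa only [sub_sub] using hd.sub dvd_rfl
    have hξ₀ : ξ ≠ 0 := ne_zero_of_orderOf_pos hξ
    rw [laplaceValue_eq_zpow hξ h_shift, laplaceValue_eq_zpow hξ hd, add_mul, neg_add,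
      zpow_add₀ hξ₀, ← mul_neg (orderOf ξ : ℤ), zpow_mul ξ (orderOf ξ : ℤ), zpow_natCast,
      pow_orderOf_eq_one, one_zpow, mul_one]
  · have h_shift : ¬ (b.gcd (orderOf ξ) : ℤ) ∣ a + orderOf ξ := by
      rwa [dvd_add_left (Int.gcd_dvd_right ..)]
    rw [laplaceValue_eq_zero h, laplaceValue_eq_zero h_shift]

theorem laplaceValue_neg (hξ : 0 < orderOf ξ) (a : ℤ) :
    laplaceValue b ξ (-a) = laplaceValue b ξ a := by
  by_cases h : (b.gcd (orderOf ξ) : ℤ) ∣ a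
  · simpa using laplaceValue_mul hξ h (-1)
  · rw [laplaceValue_eq_zero h, laplaceValue_eq_zero (by rwa [dvd_neg])]

theorem laplaceValue_zero (hξ : 0 < orderOf ξ) : laplaceValue b ξ 0 = 1 := by
  simpa using laplaceValue_eq_zpow (b := b) (a := 0) (d := 0) hξ (by simp)

theorem laplaceValue_one_pow_natAbs (hξ : 0 < orderOf ξ) (h : b.gcd (orderOf ξ) = 1) :
    laplaceValue b ξ 1 ^ b.natAbs = ξ ^ (-b.sign) := by
  obtain ⟨d, hd⟩ := exists_dvd_mul_sub_iff.2 (show (b.gcd (orderOf ξ) : ℤ) ∣ 1 by simp [h])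
  have hξ₀ : ξ ≠ 0 := ne_zero_of_orderOf_pos hξ
  rw [laplaceValue_eq_zpow hξ hd, ← zpow_natCast, ← zpow_mul,
    ← div_eq_one_iff_eq (zpow_ne_zero _ hξ₀), ← zpow_sub₀ hξ₀,
    (IsPrimitiveRoot.orderOf ξ).zpow_eq_one_iff_dvd]
  refine hd.trans ⟨-b.sign, ?_⟩
  rw [← Int.sign_mul_self_eq_natAbs]
  ring

theorem laplaceValue_one_ne_one (hξ : 1 < orderOf ξ) : laplaceValue b ξ 1 ≠ 1 := by
  by_cases h : (b.gcd (orderOf ξ) : ℤ) ∣ 1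
  · obtain ⟨d, hd⟩ := exists_dvd_mul_sub_iff.2 h
    rw [laplaceValue_eq_zpow (by lia) hd, Ne, (IsPrimitiveRoot.orderOf ξ).zpow_eq_one_iff_dvd,
      one_mul, dvd_neg]
    intro h_dvd
    have h_one : (orderOf ξ : ℤ) ∣ 1 := by simpa using (h_dvd.mul_left b).sub hd
    have := Int.le_of_dvd one_pos h_one
    lia
  · rw [laplaceValue_eq_zero h]
    exact zero_ne_one

theorem quadSum_eq_mul_laplaceValue {r : ℕ} [NeZero r] (hξ : IsPrimitiveRoot ξ r) {η : K}
    (hη : η ^ r = 1) (hη_four : η ^ 4 = ξ) (a : ℤ) :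
    quadSum (AddChar.zmodChar r hη) b a
      = quadSum (AddChar.zmodChar r hη) b 0 * laplaceValue b ξ a := by
  obtain rfl : r = orderOf ξ := hξ.eq_orderOf
  have hpos : 0 < orderOf ξ := NeZero.pos _
  have hψ_four (x : ℤ) : AddChar.zmodChar _ hη (4 * x) = ξ ^ x := by
    have h_pow : η ^ (4 * x) = ξ ^ x := by
      rw [← hη_four, zpow_mul]
      norm_cast
    rw [← h_pow, ← zmodChar_intCast hη]
    simp
  by_cases h : (b.gcd (orderOf ξ) : ℤ) ∣ a
  · obtain ⟨d, hd⟩ := exists_dvd_mul_sub_iff.2 h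
    have hbd : (b : ZMod (orderOf ξ)) * d = a := by
      rw [← Int.cast_mul, eq_comm, ZMod.intCast_eq_intCast_iff_dvd_sub]
      exact hd
    rw [quadSum_of_mul_eq _ hbd, laplaceValue_eq_zpow hpos hd, ← hψ_four, mul_comm]
    congr 2
    push_cast
    ring
  · obtain ⟨t, ht⟩ : (b.gcd (orderOf ξ) : ℤ) ∣ orderOf ξ := Int.gcd_dvd_right ..
    obtain ⟨m, hm⟩ : (b.gcd (orderOf ξ) : ℤ) ∣ b := Int.gcd_dvd_left ..
    rw [laplaceValue_eq_zero h, mul_zero]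
    refine quadSum_eq_zero _ (t := (t : ZMod (orderOf ξ))) ?_ ?_
    · rw [← Int.cast_mul, ZMod.intCast_zmod_eq_zero_iff_dvd]
      exact ⟨m, by linear_combination t * hm - m * ht⟩
    · rw [mul_assoc, ← Int.cast_mul, hψ_four, Ne, hξ.zpow_eq_one_iff_dvd]
      have ht₀ : t ≠ 0 := by
        rintro rfl
        lia
      exact fun h_dvd => h ((mul_dvd_mul_iff_right ht₀).1 (ht ▸ h_dvd))

end LaplaceValue

/-! ### Sums over odd colors -/

section SymmetricProduct

variable {F : Type*} [Field F] {u x : F}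

theorem prod_add_inv_sub_eq (hu : u ≠ 0) (hx : x ≠ 0) (k : ℕ) :
    ∏ i ∈ range (k + 1), (x + x⁻¹ - u ^ (i : ℤ) - u ^ (-(i : ℤ)))
      = (1 - x) * x ^ (-1 - (k : ℤ))
        * ∏ l ∈ range (2 * k + 1), (1 - x * u ^ (-(k : ℤ)) * u ^ l) := by
  have h_factor (i : ℕ) : x + x⁻¹ - u ^ (i : ℤ) - u ^ (-(i : ℤ))
      = x⁻¹ * ((1 - x * u ^ (-(i : ℤ))) * (1 - x * u ^ i)) := by
    rw [zpow_neg, zpow_natCast]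
    field_simp
    ring
  have h_split : ∏ l ∈ range (2 * k + 1), (1 - x * u ^ (-(k : ℤ)) * u ^ l)
      = (∏ l ∈ range k, (1 - x * u ^ (-((l + 1 : ℕ) : ℤ))))
        * ∏ l ∈ range (k + 1), (1 - x * u ^ l) := by
    rw [show 2 * k + 1 = k + (k + 1) by ring, prod_range_add, ← prod_range_reflect]
    congr 1
    · refine prod_congr rfl fun l hl => ?_
      have hl' := mem_range.1 hl
      rw [mul_assoc, ← zpow_natCast, ← zpow_add₀ hu]
      congr 3
      lia
    · refine prod_congr rfl fun l _ => ?_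
      rw [mul_assoc, pow_add, ← mul_assoc (u ^ (-(k : ℤ))), zpow_neg, zpow_natCast,
        inv_mul_cancel₀ (pow_ne_zero k hu), one_mul]
  have h_pow : x ^ (-1 - (k : ℤ)) = x⁻¹ ^ (k + 1) := by
    rw [inv_pow, ← zpow_natCast, ← zpow_neg]
    congr 1
    push_cast
    ring
  rw [h_split, h_pow]
  simp_rw [h_factor]
  rw [prod_mul_distrib, prod_mul_distrib, prod_const, card_range,
    prod_range_succ' (fun i : ℕ => 1 - x * u ^ (-(i : ℤ)))]
  simp only [Nat.cast_zero, neg_zero, zpow_zero, mul_one]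
  ring

theorem foldedSum_zpow (hu : u ≠ 0) (hx : x ≠ 0) {k : ℕ} (hk : qPochAt u (2 * k + 1) ≠ 0) :
    foldedSum u k (fun a => x ^ a - x ^ (a + 1))
      = (-1) ^ (k + 1) * u ^ ((k + 1).choose 2) * qPochAt u k
        * ∏ i ∈ range (k + 1), (x + x⁻¹ - u ^ (i : ℤ) - u ^ (-(i : ℤ))) := by
  have h_mul : foldedSum u k (fun a => x ^ a - x ^ (a + 1))
      = (1 - x) * foldedSum u k (fun a => x ^ a) := by
    simpa [sub_mul, zpow_add_one₀ hx, mul_comm x] using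
      foldedSum_sum_mul {()} u k (fun _ => 1 - x) fun _ a => x ^ a
  have h_bailey := baileySum_foldedTerm hu hx k hk
  rw [h_mul, foldedSum_eq_baileySum hk, prod_add_inv_sub_eq hu hx]
  unfold foldedTerm at h_bailey
  rw [h_bailey]
  field_simp

end SymmetricProduct

theorem exists_fourth_root_of_odd {M : Type*} [CommMonoid M] {ξ : M} {r : ℕ}
    (hξ : IsPrimitiveRoot ξ r) (hr : Odd r) : ∃ η : M, η ^ 4 = ξ ∧ IsPrimitiveRoot η r := by
  have h_coprime : Nat.Coprime 4 (orderOf ξ) := by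
    rw [← hξ.eq_orderOf]
    exact (Nat.coprime_two_left.2 hr).pow_left 2
  obtain ⟨m, hm⟩ := exists_pow_eq_self_of_coprime h_coprime
  have h_four : (ξ ^ m) ^ 4 = ξ := by rw [pow_right_comm, hm]
  refine ⟨ξ ^ m, h_four, ?_, fun l hl => hξ.dvd_of_pow_eq_one l ?_⟩
  · rw [pow_right_comm, hξ.pow_eq_one, one_pow]
  · calc ξ ^ l = ((ξ ^ m) ^ 4) ^ l := by rw [h_four]
      _ = 1 := by rw [pow_right_comm, hl, one_pow]

section GaussQuotient

variable {K : Type*} [Field K] {b : ℤ} {ξ : K} {r : ℕ}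

/-- The Gauss sum `∑ q^{b(n²-1)/4}` at `q = ξ` over the odd colors `n`. -/
def oddGaussSum (b : ℤ) (ξ : K) (r : ℕ) : K :=
  ∑ n ∈ (Ioo 0 (2 * r)).filter Odd, ξ ^ (b * (((n : ℤ) ^ 2 - 1) / 4))

theorem sum_odd_zpow_eq_quadSum [NeZero r] (hr : Odd r) {η : K} (hη : η ^ r = 1)
    (hη_four : η ^ 4 = ξ) (a : ℤ) :
    ∑ n ∈ (Ioo 0 (2 * r)).filter Odd,
        ξ ^ (b * (((n : ℤ) ^ 2 - 1) / 4)) * (ξ ^ (n : ℤ)) ^ a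
      = η ^ (-b) * quadSum (AddChar.zmodChar r hη) b a := by
  have hη₀ : η ≠ 0 := (IsUnit.of_pow_eq_one hη (NeZero.ne r)).ne_zero
  have hξη (x : ℤ) : ξ ^ x = η ^ (4 * x) := by
    rw [← hη_four, zpow_mul]
    norm_cast
  rw [quadSum, ← sum_odd_eq_sum_zmod hr, mul_sum]
  refine sum_congr rfl fun n hn => ?_
  obtain ⟨m, rfl⟩ := (mem_filter.1 hn).2
  have h_div : (((2 * m + 1 : ℕ) : ℤ) ^ 2 - 1) / 4 = m ^ 2 + m := by
    rw [show ((2 * m + 1 : ℕ) : ℤ) ^ 2 - 1 = 4 * (m ^ 2 + m) by push_cast; ring]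
    exact Int.mul_ediv_cancel_left _ four_ne_zero
  have h_cast : (b : ZMod r) * ((2 * m + 1 : ℕ) : ZMod r) ^ 2
        + 4 * (a : ZMod r) * ((2 * m + 1 : ℕ) : ZMod r)
      = ((b * (2 * m + 1) ^ 2 + 4 * a * (2 * m + 1) : ℤ) : ZMod r) := by
    push_cast
    ring
  rw [h_div, h_cast, zmodChar_intCast, ← zpow_mul, hξη, hξη, ← zpow_add₀ hη₀, ← zpow_add₀ hη₀]
  congr 1
  push_cast
  ring

theorem oddGaussSum_eq_quadSum [NeZero r] (hr : Odd r) {η : K} (hη : η ^ r = 1)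
    (hη_four : η ^ 4 = ξ) :
    oddGaussSum b ξ r = η ^ (-b) * quadSum (AddChar.zmodChar r hη) b 0 := by
  simpa [oddGaussSum] using sum_odd_zpow_eq_quadSum (b := b) hr hη hη_four 0

theorem sum_odd_zpow_eq_mul_laplaceValue (hξ : IsPrimitiveRoot ξ r) (hr : Odd r) (a : ℤ) :
    ∑ n ∈ (Ioo 0 (2 * r)).filter Odd,
        ξ ^ (b * (((n : ℤ) ^ 2 - 1) / 4)) * (ξ ^ (n : ℤ)) ^ a
      = oddGaussSum b ξ r * laplaceValue b ξ a := by
  have : NeZero r := ⟨hr.pos.ne'⟩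
  obtain ⟨η, hη_four, hη⟩ := exists_fourth_root_of_odd hξ hr
  rw [sum_odd_zpow_eq_quadSum hr hη.pow_eq_one hη_four,
    oddGaussSum_eq_quadSum hr hη.pow_eq_one hη_four,
    quadSum_eq_mul_laplaceValue hξ hη.pow_eq_one hη_four, mul_assoc]

theorem oddGaussSum_ne_zero [CharZero K] (hξ : IsPrimitiveRoot ξ r) (hr : Odd r) :
    oddGaussSum b ξ r ≠ 0 := by
  have : NeZero r := ⟨hr.pos.ne'⟩
  obtain ⟨η, hη_four, hη⟩ := exists_fourth_root_of_odd hξ hr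
  have h_two : IsUnit (2 : ZMod r) := by
    exact_mod_cast (ZMod.isUnit_iff_coprime 2 r).2 (Nat.coprime_two_left.2 hr)
  rw [oddGaussSum_eq_quadSum hr hη.pow_eq_one hη_four]
  exact mul_ne_zero (zpow_ne_zero _ (hη.ne_zero (NeZero.ne r)))
    (quadSum_zero_ne_zero (AddChar.zmodChar_primitive_of_primitive_root r hη) h_two _)

theorem sum_odd_mul_foldedSum_zpow (hξ : IsPrimitiveRoot ξ r) (hr : Odd r) (k : ℕ) :
    ∑ n ∈ (Ioo 0 (2 * r)).filter Odd, ξ ^ (b * (((n : ℤ) ^ 2 - 1) / 4))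
        * foldedSum ξ k (fun a => (ξ ^ (n : ℤ)) ^ a - (ξ ^ (n : ℤ)) ^ (a + 1))
      = 2 * oddGaussSum b ξ r * foldedSum ξ k (laplaceValue b ξ) := by
  have hpos : 0 < orderOf ξ := hξ.eq_orderOf ▸ hr.pos
  rw [← foldedSum_sum_mul]
  simp_rw [mul_sub, sum_sub_distrib, sum_odd_zpow_eq_mul_laplaceValue hξ hr, foldedSum, mul_sum]
  refine sum_congr rfl fun a _ => ?_
  have h_neg : laplaceValue b ξ (-1 - a + 1) = laplaceValue b ξ a := by
    rw [← laplaceValue_neg hpos]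
    ring_nf
  have h_succ : laplaceValue b ξ (a + 1) = laplaceValue b ξ (-1 - a) := by
    rw [← laplaceValue_neg hpos]
    ring_nf
  rw [h_neg, h_succ]
  ring

end GaussQuotient

section UnknotQuotient

variable {b : ℤ} {ξ : ℂ} {r : ℕ}

theorem hasEv_unknot_term (hξ : ξ ≠ 0) (n : ℕ) :
    HasEv ξ (quantumInt n * jonesUnknot b n) (ξ ^ (b * (((n : ℤ) ^ 2 - 1) / 4))
      * (ξ ^ (-(((n : ℤ) - 1) / 2)) * ∑ i ∈ range n, ξ ^ i) ^ 2) := by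
  have h := (hasEv_quantumInt hξ n).mul ((hasEv_framing hξ b n).mul (hasEv_quantumInt hξ n))
  rwa [mul_left_comm (ξ ^ (-(((n : ℤ) - 1) / 2)) * _), ← sq] at h

theorem FUnknot_one_one (b : ℤ) : FUnknot b 1 1 = 1 := by
  have h_filter : (Ioo 0 (2 * 1)).filter Odd = {1} := by decide
  rw [FUnknot, oddSum, h_filter, sum_singleton, ev, (hasEv_unknot_term one_ne_zero 1).2]
  simp

theorem FUnknot_eq (hξ : IsPrimitiveRoot ξ r) (hr : Odd r) (hr_one : 1 < r) :
    FUnknot b ξ r = 2 * oddGaussSum b ξ r * (ξ / (1 - ξ) ^ 2 * (laplaceValue b ξ 1 - 1)) := by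
  have hξ₀ : ξ ≠ 0 := hξ.ne_zero hr.pos.ne'
  have hξ₁ : 1 - ξ ≠ 0 := sub_ne_zero.2 (hξ.ne_one hr_one).symm
  have hpos : 0 < orderOf ξ := hξ.eq_orderOf ▸ hr.pos
  calc FUnknot b ξ r = ∑ n ∈ (Ioo 0 (2 * r)).filter Odd, ξ / (1 - ξ) ^ 2
        * (ξ ^ (b * (((n : ℤ) ^ 2 - 1) / 4)) * (ξ ^ (n : ℤ)) ^ (1 : ℤ)
          + ξ ^ (b * (((n : ℤ) ^ 2 - 1) / 4)) * (ξ ^ (n : ℤ)) ^ (-1 : ℤ)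
          - 2 * (ξ ^ (b * (((n : ℤ) ^ 2 - 1) / 4)) * (ξ ^ (n : ℤ)) ^ (0 : ℤ))) := by
        rw [FUnknot, oddSum]
        refine sum_congr rfl fun n hn => ?_
        obtain ⟨m, rfl⟩ := (mem_filter.1 hn).2
        have h_half : (((2 * m + 1 : ℕ) : ℤ) - 1) / 2 = m := by lia
        have h_geom : ∑ i ∈ range (2 * m + 1), ξ ^ i = (1 - ξ ^ (2 * m + 1)) / (1 - ξ) := by
          rw [eq_div_iff hξ₁, geom_sum_mul_neg]
        rw [ev, (hasEv_unknot_term hξ₀ _).2, h_half, h_geom]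
        simp only [zpow_neg, zpow_natCast, zpow_one, zpow_zero]
        field_simp
        ring
    _ = ξ / (1 - ξ) ^ 2 * (oddGaussSum b ξ r * laplaceValue b ξ 1
          + oddGaussSum b ξ r * laplaceValue b ξ (-1)
          - 2 * (oddGaussSum b ξ r * laplaceValue b ξ 0)) := by
        simp only [← mul_sum, sum_sub_distrib, sum_add_distrib,
          sum_odd_zpow_eq_mul_laplaceValue hξ hr]
    _ = 2 * oddGaussSum b ξ r * (ξ / (1 - ξ) ^ 2 * (laplaceValue b ξ 1 - 1)) := by
        rw [laplaceValue_neg hpos, laplaceValue_zero hpos]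
        ring

theorem FUnknot_ne_zero (hξ : IsPrimitiveRoot ξ r) (hr : Odd r) : FUnknot b ξ r ≠ 0 := by
  rcases eq_or_lt_of_le (Nat.succ_le_iff.2 hr.pos) with rfl | hr_one
  · obtain rfl : ξ = 1 := by simpa using hξ
    rw [FUnknot_one_one]
    exact one_ne_zero
  · have hξ₁ : 1 - ξ ≠ 0 := sub_ne_zero.2 (hξ.ne_one hr_one).symm
    rw [FUnknot_eq hξ hr hr_one]
    exact mul_ne_zero (mul_ne_zero two_ne_zero (oddGaussSum_ne_zero hξ hr))
      (mul_ne_zero (div_ne_zero (hξ.ne_zero hr.pos.ne') (pow_ne_zero 2 hξ₁))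
        (sub_ne_zero.2 (laplaceValue_one_ne_one (hξ.eq_orderOf ▸ hr_one))))

theorem oddSum_framing_mul_A_zero (hξ : IsPrimitiveRoot ξ r) (hr : Odd r) :
    oddSum ξ r (fun n => framing b n * A n 0) = ξ⁻¹ * FUnknot b ξ r := by
  have hξ₀ : ξ ≠ 0 := hξ.ne_zero hr.pos.ne'
  rw [FUnknot, oddSum, oddSum, mul_sum]
  refine sum_congr rfl fun n hn => ?_
  have h_term : framing b n * A n 0 = q ^ (-1 : ℤ) * (quantumInt n * jonesUnknot b n) := by
    rw [A_zero_eq (mem_filter.1 hn).2, jonesUnknot]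
    ring
  rw [h_term, ev, ev, ((hasEv_X_zpow hξ₀ (-1)).mul (hasEv_unknot_term hξ₀ n)).2,
    (hasEv_unknot_term hξ₀ n).2, zpow_neg_one]

theorem oddSum_framing_mul_A (hξ : IsPrimitiveRoot ξ r) (hr : Odd r) {k : ℕ} (hk : 2 * k + 1 < r) :
    oddSum ξ r (fun n => framing b n * A n k)
      = (-1) ^ (k + 1) / (ξ ^ ((k + 1).choose 2) * (1 - ξ) * qPochAt ξ (2 * k + 1))
        * (2 * oddGaussSum b ξ r * foldedSum ξ k (laplaceValue b ξ)) := by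
  have hξ₀ : ξ ≠ 0 := hξ.ne_zero hr.pos.ne'
  have hξ₁ : 1 - ξ ≠ 0 := sub_ne_zero.2 (hξ.ne_one (by lia)).symm
  have h_poch := qPochAt_ne_zero_of_lt hξ hk
  set T := ∏ j ∈ range (k + 1), (1 - ξ ^ (k + 1) * ξ ^ j) with hT
  have h_split : qPochAt ξ k * T = qPochAt ξ (2 * k + 1) := by
    rw [← qPochAt_mul_prod_Ico ξ (show k ≤ 2 * k + 1 by lia), prod_Ico_eq_prod_range,
      show 2 * k + 1 - k = k + 1 by lia, hT]
    exact congrArg _ (prod_congr rfl fun j _ => by ring)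
  have hT₀ : T ≠ 0 := right_ne_zero_of_mul (h_split ▸ h_poch)
  rw [← sum_odd_mul_foldedSum_zpow hξ hr, oddSum, mul_sum]
  refine sum_congr rfl fun n _ => ?_
  have h_sign : ((-1 : ℂ) ^ (k + 1)) * (-1) ^ (k + 1) = 1 := by
    rw [← mul_pow, neg_one_mul, neg_neg, one_pow]
  rw [ev, ((hasEv_framing hξ₀ b n).mul (hasEv_A hξ₀ n k (mul_ne_zero hξ₁ hT₀))).2,
    foldedSum_zpow hξ₀ (zpow_ne_zero _ hξ₀) h_poch, ← hT, ← h_split, zpow_neg ξ (n : ℤ)]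
  have h_poch' : qPochAt ξ k ≠ 0 := left_ne_zero_of_mul (h_split ▸ h_poch)
  generalize ∏ i ∈ range (k + 1),
    (ξ ^ (n : ℤ) + (ξ ^ (n : ℤ))⁻¹ - ξ ^ (i : ℤ) - ξ ^ (-(i : ℤ))) = P
  field_simp
  linear_combination (-P) * h_sign

end UnknotQuotient

/-! ### The interpolating family -/

section Family

variable {K : Type*} [Field K] [CharZero K] {b : ℤ} {ξ : K}

/-- The expansion at `q = ξ` of the Laplace transform of `x^a`, that is, of `q^{-a²/b}`. -/
def laplaceSeries (b : ℤ) (ξ : K) (a : ℤ) : K⟦X⟧ :=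
  PowerSeries.C (laplaceValue b ξ a) * pexp (-((a : K) ^ 2 / b))

@[simp] theorem constantCoeff_laplaceSeries (b : ℤ) (ξ : K) (a : ℤ) :
    PowerSeries.constantCoeff (laplaceSeries b ξ a) = laplaceValue b ξ a := by
  simp [laplaceSeries]

theorem laplaceSeries_mul (hξ : 0 < orderOf ξ) {a : ℤ} (h : (b.gcd (orderOf ξ) : ℤ) ∣ a) (x : ℤ) :
    laplaceSeries b ξ (a * x) = laplaceSeries b ξ a ^ (x.natAbs ^ 2) := by
  have h_value : laplaceValue b ξ (a * x) = laplaceValue b ξ a ^ (x.natAbs ^ 2) := by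
    rw [laplaceValue_mul hξ h, ← zpow_natCast, Nat.cast_pow, Int.natAbs_sq]
  have h_exponent : ((x.natAbs ^ 2 : ℕ) : K) = (x : K) ^ 2 := by
    rw [← Int.cast_natCast, Nat.cast_pow, Int.natAbs_sq, Int.cast_pow]
  rw [laplaceSeries, laplaceSeries, mul_pow, pexp_pow, ← map_pow, h_value, h_exponent]
  congr 2
  push_cast
  ring

/-- The expansion at `q = ξ` of a function with value `(1 - q) / (L(x) - 1)` there, where `L` is
the Laplace transform. If `b` is prime to the order of `ξ`, then `L(x)^b = q⁻¹` turns the quotient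
into a geometric sum, and otherwise `L(x) = 0`. -/
def unknotFactor (b : ℤ) (ξ : K) : K⟦X⟧ :=
  if b.gcd (orderOf ξ) = 1 then
    (if 0 < b then localVar ξ else -1) * ∑ i ∈ range b.natAbs, laplaceSeries b ξ 1 ^ i
  else localVar ξ - 1

theorem constantCoeff_unknotFactor_mul (hb : b ≠ 0) (hξ : 0 < orderOf ξ) :
    PowerSeries.constantCoeff (unknotFactor b ξ) * (laplaceValue b ξ 1 - 1) = 1 - ξ := by
  rw [unknotFactor]
  split_ifs with h_gcd h_sign
  · have h_pow := laplaceValue_one_pow_natAbs hξ h_gcd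
    rw [Int.sign_eq_one_of_pos h_sign, zpow_neg_one] at h_pow
    simp only [map_mul, map_sum, map_pow, constantCoeff_laplaceSeries, constantCoeff_localVar]
    rw [mul_assoc, geom_sum_mul, h_pow, mul_sub,
      mul_inv_cancel₀ (ne_zero_of_orderOf_pos hξ), mul_one]
  · have h_pow := laplaceValue_one_pow_natAbs hξ h_gcd
    rw [Int.sign_eq_neg_one_of_neg (by lia), neg_neg, zpow_one] at h_pow
    simp only [map_mul, map_sum, map_pow, map_neg, map_one, constantCoeff_laplaceSeries]
    rw [mul_assoc, geom_sum_mul, h_pow, neg_one_mul, neg_sub]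
  · have h_ndvd : ¬ (b.gcd (orderOf ξ) : ℤ) ∣ 1 := by
      exact_mod_cast mt Nat.dvd_one.1 h_gcd
    rw [laplaceValue_eq_zero h_ndvd, map_sub, map_one, constantCoeff_localVar]
    ring

/-- The expansion at `q = ξ` of `(q;q)_{2k+1}` times the quotient of `∑_n q^{b(n²-1)/4} A(n,k)` by
`F_{U^b}`. -/
def quotientNum (b : ℤ) (k : ℕ) (ξ : K) : K⟦X⟧ :=
  (-1) ^ (k + 1) * localPow ξ (-1) ^ ((k + 1).choose 2 + 1) * unknotFactor b ξ
    * foldedSum (localVar ξ) k (laplaceSeries b ξ)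

theorem qPochAt_dvd_quotientNum (b : ℤ) (k : ℕ) (hξ : 0 < orderOf ξ) :
    qPochAt (localVar ξ) (2 * k + 1) ∣ quotientNum b k ξ := by
  refine Dvd.dvd.mul_left ?_ _
  have h_series : laplaceSeries b ξ
      = fun a => PowerSeries.C (laplaceValue b ξ a) * pexp (-(b : K)⁻¹ * (a : K) ^ 2) := by
    funext a
    rw [laplaceSeries, div_eq_inv_mul, neg_mul]
  rw [h_series]
  exact qPochAt_dvd_foldedSum_of_periodic hξ k (laplaceValue_periodic hξ) _

theorem constantCoeff_quotientNum (hb : b ≠ 0) (k : ℕ) (hξ : 1 < orderOf ξ) :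
    PowerSeries.constantCoeff (quotientNum b k ξ)
      = (-1) ^ (k + 1) * ξ⁻¹ ^ ((k + 1).choose 2 + 1) * ((1 - ξ) / (laplaceValue b ξ 1 - 1))
        * foldedSum ξ k (laplaceValue b ξ) := by
  have h_factor : PowerSeries.constantCoeff (unknotFactor b ξ)
      = (1 - ξ) / (laplaceValue b ξ 1 - 1) :=
    eq_div_of_mul_eq (sub_ne_zero.2 (laplaceValue_one_ne_one hξ))
      (constantCoeff_unknotFactor_mul hb (by lia))
  rw [quotientNum]
  simp [h_factor, map_foldedSum, localPow]

variable {R : Type*} [CommRing R] [Algebra R K] {S : Set ℕ}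

theorem sign_mul_sign (hb : b ≠ 0) : b.sign * b.sign = 1 := by
  rw [← Int.sign_mul, Int.sign_eq_one_of_pos (mul_self_pos.2 hb)]

theorem sq_div_eq_mul_sign_div (hb : b ≠ 0) {c n : ℕ} (hn : b.natAbs = c * n) :
    (c : K) ^ 2 / b = c * b.sign / n := by
  have h_sign : (b.sign : K) * b.sign = 1 := by exact_mod_cast sign_mul_sign hb
  have h_mul : (b : K) = b.sign * (c * n) := by
    rw [← Nat.cast_mul, ← hn, ← Int.cast_natCast, ← Int.cast_mul, Int.sign_mul_natAbs]
  have hn₀ : n ≠ 0 := right_ne_zero_of_mul (hn ▸ Int.natAbs_ne_zero.2 hb)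
  rw [div_eq_div_iff (Int.cast_ne_zero.2 hb) (Nat.cast_ne_zero.2 hn₀), h_mul]
  linear_combination (-(c : K) ^ 2 * n) * h_sign

theorem realizable_laplaceSeries_natCast (hb : IsUnit (b.natAbs : R)) {c : ℕ}
    (hc : c ∣ b.natAbs) :
    Realizable R {r ∈ S | b.natAbs.gcd r = c} fun ξ : K => laplaceSeries b ξ c := by
  have hbK : (b.natAbs : K) ≠ 0 := by simpa using (hb.map (algebraMap R K)).ne_zero
  have hb₀ : b ≠ 0 := by
    rintro rfl
    exact hbK (by simp)
  have hc₀ : 0 < c := Nat.pos_of_dvd_of_pos hc (Int.natAbs_pos.2 hb₀)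
  obtain ⟨n, hn⟩ := hc
  have hn_unit : IsUnit (n : R) := isUnit_of_mul_isUnit_right (by rwa [← Nat.cast_mul, ← hn])
  have h_sign := sign_mul_sign hb₀
  have hb_eq : b = b.sign * (c * n) := by rw [← Nat.cast_mul, ← hn, Int.sign_mul_natAbs]
  refine (realizable_fractional_pow (c := c) (ω := fun ξ => laplaceValue b ξ c) hn_unit b.sign
    ?_ ?_).congr fun ξ _ _ => ?_
  · rintro r ⟨-, rfl⟩
    have h_coprime := Nat.coprime_div_gcd_div_gcd hc₀
    rw [Nat.div_eq_of_eq_mul_right hc₀ hn] at h_coprime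
    exact ⟨Nat.gcd_dvd_right .., h_coprime.symm⟩
  · rintro ξ hξ - m hm
    have h_dvd : (orderOf ξ : ℤ) ∣ b * (-m) - c := by
      have h_eq : b * (-m) - c = c * (m * n + b.sign) * -b.sign := by
        linear_combination (-(m : ℤ)) * hb_eq + (c : ℤ) * h_sign
      exact h_eq ▸ hm.mul_right _
    rw [laplaceValue_eq_zpow hξ h_dvd, mul_neg, neg_neg]
    exact_mod_cast rfl
  · rw [laplaceSeries, Int.cast_natCast, sq_div_eq_mul_sign_div hb₀ hn]

theorem realizable_laplaceSeries (hb : IsUnit (b.natAbs : R)) {c : ℕ} (hc : c ∣ b.natAbs) (a : ℤ) :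
    Realizable R {r ∈ S | b.natAbs.gcd r = c} fun ξ : K => laplaceSeries b ξ a := by
  by_cases hca : (c : ℤ) ∣ a
  · obtain ⟨x, rfl⟩ := hca
    refine ((realizable_laplaceSeries_natCast hb hc).pow (x.natAbs ^ 2)).congr fun ξ hξ h_gcd => ?_
    exact (laplaceSeries_mul hξ (h_gcd.2 ▸ dvd_rfl) x).symm
  · refine (Realizable.of_aeval R _ 0).congr fun ξ _ h_gcd => ?_
    obtain ⟨-, rfl⟩ := h_gcd
    rw [laplaceSeries, laplaceValue_eq_zero hca, map_zero, map_zero, zero_mul]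

theorem realizable_unknotFactor (hb : IsUnit (b.natAbs : R)) {c : ℕ} (hc : c ∣ b.natAbs) :
    Realizable R {r ∈ S | b.natAbs.gcd r = c} (unknotFactor (K := K) b) := by
  by_cases h : c = 1
  · refine ((Realizable.of_aeval R _ (if 0 < b then X else -1)).mul
      (.sum (range b.natAbs) fun i _ => (realizable_laplaceSeries hb hc 1).pow i)).congr
        fun ξ _ h_gcd => ?_
    have h_one : b.gcd (orderOf ξ) = 1 := h_gcd.2.trans h
    rw [unknotFactor, if_pos h_one, apply_ite (aeval (localVar ξ))]
    simp
  · refine (Realizable.of_aeval R _ (X - 1)).congr fun ξ _ h_gcd => ?_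
    have h_ne_one : b.gcd (orderOf ξ) ≠ 1 := fun h_one => h (h_gcd.2.symm.trans h_one)
    rw [unknotFactor, if_neg h_ne_one]
    simp

theorem realizable_quotientNum (hb : IsUnit (b.natAbs : R)) (k : ℕ) :
    Realizable R S (quotientNum (K := K) b k) := by
  refine Realizable.of_gcd_eq hb fun c hc => ?_
  have h_sign : Realizable R {r ∈ S | b.natAbs.gcd r = c} fun _ : K => (-1) ^ (k + 1) :=
    (Realizable.of_aeval R _ ((-1) ^ (k + 1))).congr fun ξ _ _ => by simp
  exact ((h_sign.mul ((realizable_localPow_neg_one R _).pow _)).mul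
    (realizable_unknotFactor hb hc)).mul (.foldedSum (realizable_laplaceSeries hb hc) k)

theorem exists_realizable_quotient [IsAlgClosed K] (hR : Function.Injective (algebraMap R K))
    (hb : IsUnit (b.natAbs : R)) (k : ℕ) :
    ∃ G : K → K⟦X⟧, Realizable R Set.univ G ∧
      ∀ ξ, 0 < orderOf ξ → qPochAt (localVar ξ) (2 * k + 1) * G ξ = quotientNum b k ξ := by
  choose! G hG using fun (ξ : K) (hξ : 0 < orderOf ξ) => qPochAt_dvd_quotientNum b k hξ
  exact ⟨G, .of_qPoch_mul hR ((realizable_quotientNum hb k).congr fun ξ hξ _ => hG ξ hξ),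
    fun ξ hξ => (hG ξ hξ).symm⟩

end Family

theorem isUnit_natAbs_ZInv {b : ℤ} (hb : b ≠ 0) : IsUnit (b.natAbs : ZInv b) := by
  have hb' : (b : ℚ) ≠ 0 := Int.cast_ne_zero.2 hb
  have h_unit : IsUnit (b : ZInv b) :=
    .of_mul_eq_one ⟨(b : ℚ)⁻¹, Algebra.subset_adjoin rfl⟩ (Subtype.ext (by simp [hb']))
  refine isUnit_of_dvd_unit ?_ h_unit
  rw [← Int.cast_natCast]
  exact Int.cast_dvd_cast _ _ (Int.natAbs_dvd.2 dvd_rfl)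

theorem oddSum_div_FUnknot_eq {b : ℤ} (hb : b ≠ 0) {ξ : ℂ} {r k : ℕ} (hξ : IsPrimitiveRoot ξ r)
    (hr : Odd r) (hk : 2 * k + 1 < r) {g : ℂ⟦X⟧}
    (hg : qPochAt (localVar ξ) (2 * k + 1) * g = quotientNum b k ξ) :
    oddSum ξ r (fun n => framing b n * A n k) / FUnknot b ξ r = PowerSeries.constantCoeff g := by
  have h_order : 1 < orderOf ξ := hξ.eq_orderOf ▸ (by lia)
  have hξ₀ : ξ ≠ 0 := hξ.ne_zero hr.pos.ne'
  have hξ₁ : 1 - ξ ≠ 0 := sub_ne_zero.2 (hξ.ne_one (by lia)).symm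
  have h_poch := qPochAt_ne_zero_of_lt hξ hk
  have h_laplace := sub_ne_zero.2 (laplaceValue_one_ne_one (b := b) h_order)
  have h_gauss := oddGaussSum_ne_zero (b := b) hξ hr
  have h_coeff := congrArg PowerSeries.constantCoeff hg
  rw [map_mul, map_qPochAt, constantCoeff_localVar, constantCoeff_quotientNum hb k h_order]
    at h_coeff
  rw [eq_div_of_mul_eq h_poch ((mul_comm _ _).trans h_coeff), oddSum_framing_mul_A hξ hr hk,
    FUnknot_eq hξ hr (by lia), inv_pow, pow_succ ξ]
  field_simp

end

end LaplaceTransform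

theorem theorem2p3_general (b : ℤ) (hb : b ≠ 0) (k : ℕ) :
    ∃ Q : LaplaceTransform.SRing b,
      ∀ (ξ : ℂ) (r : ℕ) (hξ : IsPrimitiveRoot ξ r) (hr : Odd r), (2 * k + 1 < r ∨ k = 0) →
        LaplaceTransform.FUnknot b ξ r ≠ 0 ∧
        LaplaceTransform.oddSum ξ r
            (fun n => LaplaceTransform.framing b n * LaplaceTransform.A n k) /
            LaplaceTransform.FUnknot b ξ r
          = LaplaceTransform.evR b hξ hr (LaplaceTransform.sToR b Q) := by
  open LaplaceTransform in
  rcases Nat.eq_zero_or_pos k with rfl | hk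
  · obtain ⟨Q, hQ⟩ := (realizable_localPow_neg_one (ZInv b) Set.univ).exists_evR_sToR_eq
    refine ⟨Q, fun ξ r hξ hr _ => ⟨FUnknot_ne_zero hξ hr, ?_⟩⟩
    rw [hQ, oddSum_framing_mul_A_zero hξ hr, mul_div_assoc, div_self (FUnknot_ne_zero hξ hr)]
    simp [localPow]
  · obtain ⟨G, h_realizable, hG⟩ :=
      exists_realizable_quotient (algebraMap_ZInv_injective b) (isUnit_natAbs_ZInv hb) k
    obtain ⟨Q, hQ⟩ := h_realizable.exists_evR_sToR_eq
    refine ⟨Q, fun ξ r hξ hr h => ⟨FUnknot_ne_zero hξ hr, ?_⟩⟩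
    rw [hQ]
    exact oddSum_div_FUnknot_eq hb hξ hr (h.resolve_right hk.ne')
      (hG ξ (hξ.eq_orderOf ▸ hr.pos))

theorem theorem2p3 (b : ℤ)
    (hb : b = 1 ∨ b = -1 ∨
      ∃ p l : ℕ, p.Prime ∧ 0 < l ∧ (b = (p : ℤ) ^ l ∨ b = -(p : ℤ) ^ l))
    (k : ℕ) :
    ∃ Q : LaplaceTransform.RRing b,
      (∀ (ξ : ℂ) (r : ℕ) (hξ : IsPrimitiveRoot ξ r) (hr : Odd r), (2 * k + 1 < r ∨ k = 0) →
        LaplaceTransform.FUnknot b ξ r ≠ 0 ∧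
        LaplaceTransform.oddSum ξ r
            (fun n => LaplaceTransform.framing b n * LaplaceTransform.A n k) /
            LaplaceTransform.FUnknot b ξ r
          = LaplaceTransform.evR b hξ hr Q) ∧
      (Odd b → ∃ Q' : LaplaceTransform.SRing b, LaplaceTransform.sToR b Q' = Q) := by
  have hb₀ : b ≠ 0 := by
    rcases hb with rfl | rfl | ⟨p, l, hp, -, rfl | rfl⟩
    · exact one_ne_zero
    · exact neg_ne_zero.2 one_ne_zero
    · exact pow_ne_zero l (Nat.cast_ne_zero.2 hp.ne_zero)
    · exact neg_ne_zero.2 (pow_ne_zero l (Nat.cast_ne_zero.2 hp.ne_zero))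
  obtain ⟨Q, hQ⟩ := theorem2p3_general b hb₀ k
  exact ⟨LaplaceTransform.sToR b Q, hQ, fun _ => ⟨Q, rfl⟩⟩
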